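/- Consider the real, single-input single-output linear time-invariant system $\dot x = Ax+Bu$, $y = Cx+Du$ with state $x(t)\in\mathbb{R}^n$, input $u(t)\in\mathbb{R}$, output $y(t)\in\mathbb{R}$, and transfer function $G(s)=C(sI-A)^{-1}B+D$. Let $p\ge 0$ be an integer, let $\Lambda=(\underline\lambda,\overline\lambda)$ with $-\infty\le\underline\lambda<\overline\lambda\le\infty$, and let $S_\Lambda=\{s\in\mathbb{C}:\operatorname{Re}s\in-\Lambda\}$. For $\lambda\in\mathbb{R}$ the $L_{2,p}$-gain $\gamma_\lambda\in[0,\infty]$ with rate $\lambda$ is the infimum (equal to $\infty$ if there is none) of all $\gamma\ge 0$ for which there are $\varepsilon\ge 0$ and a symmetric $P\in\mathbb{R}^{n\times n}$ of inertia $(p,0,n-p)$ ($p$ negative, no zero and $n-p$ positive eigenvalues) such that $$\begin{bmatrix}\dot x\\ x\end{bmatrix}^{\top}\begin{bmatrix}0&P\\P&2\lambda P+\varepsilon I\end{bmatrix}\begin{bmatrix}\dot x\\ x\end{bmatrix}\le\begin{bmatrix}y\\u\end{bmatrix}^{\top}\begin{bmatrix}-I&0\\0&\gamma^2I\end{bmatrix}\begin{bmatrix}y\\u\end{bmatrix}$$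 holds along all trajectories of the system. The $L_{2,p}(\mathbb{R}_\Lambda)$-gain is $\gamma_\Lambda=\sup_{\lambda\in\Lambda}\gamma_\lambda$. Let $H_\infty(S_\Lambda)$ be the space of analytic $f:S_\Lambda\to\mathbb{C}$ with $\|f\|_{H_\infty(S_\Lambda)}=\operatorname{ess\,sup}_{s\in S_\Lambda}|f(s)|<\infty$, and let $H_{\infty,p}(S_\Lambda)$, with the same norm, consist of those $f\in H_\infty(S_\Lambda)$ that are meromorphic on $\{\operatorname{Re}s>-\overline\lambda\}$ with exactly $p$ poles, counted with multiplicity, in the open half-plane $\{\operatorname{Re}s>-\underline\lambda\}$ to the right of $S_\Lambda$. Then: 1. For every $\lambda\in\mathbb{R}$, $\gamma_\lambda$ is also the infimum of all $\gamma\ge 0$ for which there are $\varepsilon\ge0$ and a symmetric $P\in\mathbb{R}^{n\times n}$ of inertia $(p,0,n-p)$ with $$\begin{bmatrix}A^\top P+PA+2\lambda P+\varepsilon I+C^\top C&PB+C^\top D\\B^\top P+D^\top C&-\gamma^2I+D^\top D\end{bmatrix}\le 0.$$ 2. If $\gamma_\Lambda<\infty$, then $G\in H_\infty(S_\Lambda)$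 and $\gamma_\Lambda=\|G\|_{H_\infty(S_\Lambda)}$. 3. If $G$ has $n$ poles, counted with multiplicity (no pole-zero cancellation in the realization), then $\gamma_\Lambda<\infty$ if and only if $G\in H_{\infty,p}(S_\Lambda)$, so that in this case $\gamma_\Lambda=\|G\|_{H_{\infty,p}(S_\Lambda)}$. -/

import Mathlib

open Matrix MeasureTheory
open scoped ENNReal NNReal

noncomputable section

/-- A real, single-input single-output, linear time-invariant system
`x' = A x + B u`, `y = C x + D u` with `n` states. -/
structure LTISystem (n : ℕ) where
  A : Matrix (Fin n) (Fin n) ℝ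
  B : Matrix (Fin n) (Fin 1) ℝ
  C : Matrix (Fin 1) (Fin n) ℝ
  D : Matrix (Fin 1) (Fin 1) ℝ

/-- The complex eigenvalues of a real square matrix, with algebraic multiplicity. -/
def complexEigenvalues {n : ℕ} (M : Matrix (Fin n) (Fin n) ℝ) : Multiset ℂ :=
  (M.map (algebraMap ℝ ℂ)).charpoly.roots

open Classical in
/-- The inertia of a real square matrix: the numbers of eigenvalues (with multiplicity) in the open
left half-plane, on the imaginary axis, and in the open right half-plane. -/
def inertia {n : ℕ} (M : Matrix (Fin n) (Fin n) ℝ) : ℕ × ℕ × ℕ :=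
  ((complexEigenvalues M).countP (fun z => z.re < 0),
   (complexEigenvalues M).countP (fun z => z.re = 0),
   (complexEigenvalues M).countP (fun z => 0 < z.re))

/-- The open strip of all `s` with `Re s ∈ -Λ`, where `Λ` is the open interval `(lo, hi)`. -/
def strip (lo hi : EReal) : Set ℂ := {s | lo < ((-s.re : ℝ) : EReal) ∧ ((-s.re : ℝ) : EReal) < hi}

/-- The open half-plane to the right of the strip (empty if `lo = -∞`). -/
def rightOfStrip (lo : EReal) : Set ℂ := {s | ((-s.re : ℝ) : EReal) < lo}

/-- The strip together with everything to its right. -/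
def stripAndRight (hi : EReal) : Set ℂ := {s | ((-s.re : ℝ) : EReal) < hi}

/-- The `H_∞` norm on the strip: the essential supremum of `|f|`, with values in `[0, ∞]`. -/
def hInfNorm (lo hi : EReal) (f : ℂ → ℂ) : ℝ≥0∞ :=
  essSup (fun s => ‖f s‖ₑ) (volume.restrict (strip lo hi))

/-- Membership in the Hardy space `H_∞` of the strip: analytic and (essentially) bounded there. -/
def MemHInf (lo hi : EReal) (f : ℂ → ℂ) : Prop :=
  AnalyticOnNhd ℂ f (strip lo hi) ∧ hInfNorm lo hi f < ⊤

/-- The multiplicity of `s` as a pole of `f` (zero if `s` is not a pole). -/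
def poleOrder (f : ℂ → ℂ) (s : ℂ) : ℕ := (-(meromorphicOrderAt f s).untop₀).toNat

/-- `f` has exactly `k` poles in `U`, counted with multiplicity. -/
def HasPoleCount (f : ℂ → ℂ) (U : Set ℂ) (k : ℕ) : Prop :=
  {s ∈ U | poleOrder f s ≠ 0}.Finite ∧ ∑ᶠ s ∈ U, poleOrder f s = k

/-- Membership in `H_{∞,p}` of the strip: `f` is in `H_∞` of the strip and is meromorphic on the strip
and to the right of it, with exactly `p` poles in the open half-plane to the right of the strip.
The norm of this space is `hInfNorm`. -/
def MemHInfP (p : ℕ) (lo hi : EReal) (f : ℂ → ℂ) : Prop :=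
  MemHInf lo hi f ∧ MeromorphicOn f (stripAndRight hi) ∧ HasPoleCount f (rightOfStrip lo) p

namespace LTISystem

variable {n : ℕ} (S : LTISystem n)

/-- The transfer function `G(s) = C (s I - A)⁻¹ B + D`. -/
def transfer (s : ℂ) : ℂ :=
  (S.C.map (algebraMap ℝ ℂ) * (s • (1 : Matrix (Fin n) (Fin n) ℂ) - S.A.map (algebraMap ℝ ℂ))⁻¹
    * S.B.map (algebraMap ℝ ℂ) + S.D.map (algebraMap ℝ ℂ)) 0 0

/-- `(x, u, y)` is a trajectory of the system. The linearization of a linear system along any of its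
solutions is the system itself, so these are also the trajectories `(δx, δu, δy)` of the variational
part of the prolonged system. -/
def IsTrajectory (x : ℝ → Fin n → ℝ) (u y : ℝ → Fin 1 → ℝ) : Prop :=
  ∀ t, HasDerivAt x (S.A *ᵥ x t + S.B *ᵥ u t) t ∧ y t = S.C *ᵥ x t + S.D *ᵥ u t

/-- The conic constraint with storage matrix `P`, constant `ε`, gain `γ` and rate `r` holds along all
trajectories of the system. -/
def ConicConstraint (r γ ε : ℝ) (P : Matrix (Fin n) (Fin n) ℝ) : Prop :=
  ∀ x u y, S.IsTrajectory x u y → ∀ t,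
    Sum.elim (deriv x t) (x t) ⬝ᵥ
        (fromBlocks 0 P P ((2 * r) • P + ε • (1 : Matrix (Fin n) (Fin n) ℝ)) *ᵥ
          Sum.elim (deriv x t) (x t)) ≤
      Sum.elim (y t) (u t) ⬝ᵥ
        (fromBlocks (-1) 0 0 (γ ^ 2 • (1 : Matrix (Fin 1) (Fin 1) ℝ)) *ᵥ Sum.elim (y t) (u t))

/-- The block matrix of the linear matrix inequality. -/
def lmiMatrix (r γ ε : ℝ) (P : Matrix (Fin n) (Fin n) ℝ) :
    Matrix (Fin n ⊕ Fin 1) (Fin n ⊕ Fin 1) ℝ :=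
  fromBlocks
    (S.Aᵀ * P + P * S.A + (2 * r) • P + ε • (1 : Matrix (Fin n) (Fin n) ℝ) + S.Cᵀ * S.C)
    (P * S.B + S.Cᵀ * S.D)
    (S.Bᵀ * P + S.Dᵀ * S.C)
    (-(γ ^ 2 • (1 : Matrix (Fin 1) (Fin 1) ℝ)) + S.Dᵀ * S.D)

/-- The system has `L_{2,p}`-gain less than `γ` with rate `r`. -/
def HasGain (p : ℕ) (r : ℝ) (γ : ℝ≥0) : Prop :=
  ∃ ε : ℝ, 0 ≤ ε ∧ ∃ P : Matrix (Fin n) (Fin n) ℝ,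
    P.IsSymm ∧ inertia P = (p, 0, n - p) ∧ S.ConicConstraint r γ ε P

/-- The linear matrix inequality is solvable for `γ`, with rate `r`. -/
def LMISolvable (p : ℕ) (r : ℝ) (γ : ℝ≥0) : Prop :=
  ∃ ε : ℝ, 0 ≤ ε ∧ ∃ P : Matrix (Fin n) (Fin n) ℝ,
    P.IsSymm ∧ inertia P = (p, 0, n - p) ∧ (-(S.lmiMatrix r γ ε P)).PosSemidef

/-- The `L_{2,p}`-gain `γ_r` with rate `r`, in `[0, ∞]` (it is `∞` if no `γ` is admissible). -/
def gainAt (p : ℕ) (r : ℝ) : ℝ≥0∞ := ⨅ (γ : ℝ≥0) (_ : S.HasGain p r γ), (γ : ℝ≥0∞)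

/-- The `L_{2,p}(R_Λ)`-gain, `Λ = (lo, hi)`: the supremum over the rates in `Λ`. -/
def gain (p : ℕ) (lo hi : EReal) : ℝ≥0∞ :=
  ⨆ (r : ℝ) (_ : lo < (r : EReal) ∧ (r : EReal) < hi), S.gainAt p r

end LTISystem

end

/-! Fix a rate `r`. Every state and input value occurs on some trajectory, so the conic constraint
is a pointwise quadratic inequality, namely the linear matrix inequality; this is the first claim.

Let the inequality hold with `P` and `γ`. Testing it on complex `x`, `u` with `A x + B u = z x`, `Re
z = -r`, the storage terms cancel and `|G z| ≤ γ` remains (`norm_transfer_le`). With `u = 0` it is a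
Lyapunov inequality for `A + r`, so if no eigenvalue of `A` lies on `Re s = -r`, exactly `p` of them
lie to the right (`countP_neg_eq_of_lyapunov`). Conversely, if the line is free of eigenvalues and
`|G| ≤ γ₀ < γ` on it, a strict Kalman-Yakubovich-Popov lemma produces `P`, and its inertia is again
the eigenvalue count (`lmiSolvable_of_bound`). So on a free line with count `p` the gain is the
supremum of `|G|`.

The KYP lemma needs no controllability. Were there no `P`, separating a compact convex set from a
closed one would give a nonzero state-input Gramian that is stationary and violates the bound in
total. The vectors of a suitable orthonormal basis split it into motions at single frequencies, each
obeying the bound (`exists_basis_of_comp_adjoint_skew`, `sum_sq_output_le`).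

If the gain over `Λ` is finite, the count is `p` at all but finitely many rates; an eigenvalue in
the strip would make it jump, so there is none. `G` is then continuous on the open strip, where
supremum and essential supremum agree. Without cancellation poles are eigenvalues, and boundedness
of `G` keeps them off the strip and its right boundary line, so the poles to the right of the strip
are the eigenvalues counted at any rate. -/

noncomputable section

/-! ### Stability by the Cayley transform, and spectral subspaces. -/

section Lyapunov

open Filter Topology

/-- Powers of an element of spectral radius less than one tend to zero. -/
theorem tendsto_pow_zero_of_spectrum_lt_one {𝔸 : Type*} [NormedRing 𝔸] [NormedAlgebra ℂ 𝔸]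
    [CompleteSpace 𝔸] (a : 𝔸) (h : ∀ z ∈ spectrum ℂ a, ‖z‖ < 1) :
    Tendsto (fun k : ℕ => a ^ k) atTop (𝓝 0) := by
  rcases subsingleton_or_nontrivial 𝔸 with hs | hs
  · exact tendsto_const_nhds.congr fun k => Subsingleton.elim _ _
  have hr : spectralRadius ℂ a < ((1 : ℝ≥0) : ℝ≥0∞) :=
    spectrum.spectralRadius_lt_of_forall_lt a fun z hz => by
      rw [← NNReal.coe_lt_coe]; simpa using h z hz
  obtain ⟨r, hr1, hr2⟩ := ENNReal.lt_iff_exists_nnreal_btwn.1 hr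
  have hr2' : (r : ℝ) < 1 := by exact_mod_cast hr2
  -- Gelfand's formula; `r` lies strictly between the spectral radius and 1, so the powers are
  -- eventually dominated by `r ^ k`.
  have ev := (spectrum.pow_nnnorm_pow_one_div_tendsto_nhds_spectralRadius a).eventually_lt_const hr1
  refine squeeze_zero_norm' (a := fun k : ℕ => (r : ℝ) ^ k) ?_
    (tendsto_pow_atTop_nhds_zero_of_lt_one r.2 hr2')
  filter_upwards [ev, eventually_gt_atTop 0] with k hk hk0
  have h1 : ((‖a ^ k‖₊ : ℝ≥0∞) ^ (1 / k : ℝ)) ^ (k : ℝ) ≤ (r : ℝ≥0∞) ^ (k : ℝ) :=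
    ENNReal.rpow_le_rpow hk.le (by positivity)
  rw [← ENNReal.rpow_mul, one_div, inv_mul_cancel₀ (by positivity), ENNReal.rpow_one,
    ENNReal.rpow_natCast] at h1
  have h2 : ‖a ^ k‖₊ ≤ r ^ k := by exact_mod_cast h1
  exact_mod_cast h2

/-- Lyapunov's theorem for a stable linear map `f`: a continuous function that does not increase from
`x - f x` to `x + f x` is nonnegative. -/
theorem nonneg_of_stable {V : Type*} [NormedAddCommGroup V] [NormedSpace ℂ V]
    [FiniteDimensional ℂ V] (f : Module.End ℂ V) (hf : ∀ μ, f.HasEigenvalue μ → μ.re < 0)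
    (q : V → ℝ) (hq : Continuous q) (hq0 : q 0 = 0) (hle : ∀ x, q (x + f x) ≤ q (x - f x)) (x : V) :
    0 ≤ q x := by
  have hinj : Function.Injective (1 - f : Module.End ℂ V) := by
    rw [← LinearMap.ker_eq_bot, LinearMap.ker_eq_bot']
    intro v hv
    by_contra hne
    have : f.HasEigenvalue 1 := Module.End.hasEigenvalue_of_hasEigenvector (x := v)
      ⟨Module.End.mem_eigenspace_iff.2 (by
        have : v - f v = 0 := by simpa using hv
        rw [one_smul, ← sub_eq_zero.1 this]), hne⟩
    exact absurd (hf 1 this) (by simp)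
  obtain ⟨g, hg⟩ := LinearMap.exists_rightInverse_of_surjective (1 - f : Module.End ℂ V)
    (LinearMap.range_eq_top.2 (LinearMap.injective_iff_surjective.1 hinj))
  have hg' : ∀ v, g v - f (g v) = v := fun v => by simpa using LinearMap.congr_fun hg v
  -- The Cayley transform `(1 + f)(1 - f)⁻¹` sends `x - f x` to `x + f x`, so `q` does not increase
  -- along its powers. An eigenvalue `z` of `M` comes from the eigenvalue `(z - 1) / (z + 1)` of
  -- `f`, hence `|z| < 1` and the powers tend to zero.
  let M : Module.End ℂ V := (1 + f) ∘ₗ g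
  have hM : ∀ v, M v = g v + f (g v) := fun v => by simp [M]
  let e := Module.End.toContinuousLinearMap (𝕜 := ℂ) V
  have hpow : Tendsto (fun k : ℕ => (e M) ^ k) atTop (𝓝 0) := by
    apply tendsto_pow_zero_of_spectrum_lt_one
    intro z hz
    rw [AlgEquiv.spectrum_eq, ← Module.End.hasEigenvalue_iff_mem_spectrum] at hz
    obtain ⟨v, hv, hv0⟩ := hz.exists_hasEigenvector
    rw [Module.End.mem_eigenspace_iff, hM] at hv
    have hw0 : g v ≠ 0 := fun h => hv0 (by rw [← hg' v, h]; simp)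
    have hzw : (1 + z) • f (g v) = (z - 1) • g v := by
      have : g v + f (g v) = z • (g v - f (g v)) := by rw [hg' v, hv]
      rw [smul_sub] at this
      rw [add_smul, sub_smul, one_smul, one_smul]
      linear_combination (norm := module) this
    have hz1 : 1 + z ≠ 0 := by
      intro h
      rw [h, zero_smul, eq_comm, smul_eq_zero] at hzw
      rcases hzw with h' | h'
      · have : (2 : ℂ) = 0 := by linear_combination h - h'
        norm_num at this
      · exact hw0 h'
    have hev : f.HasEigenvalue ((z - 1) / (1 + z)) :=
      Module.End.hasEigenvalue_of_hasEigenvector (x := g v)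
        ⟨Module.End.mem_eigenspace_iff.2 (by
          rw [div_eq_inv_mul, mul_smul, ← hzw, smul_smul, inv_mul_cancel₀ hz1, one_smul]), hw0⟩
    have hre := hf _ hev
    have hns : 0 < Complex.normSq (1 + z) := Complex.normSq_pos.2 hz1
    have : ((z - 1) / (1 + z)).re * Complex.normSq (1 + z) = Complex.normSq z - 1 := by
      rw [Complex.div_re]
      field_simp
      simp [Complex.normSq_apply]
      ring
    have h3 : Complex.normSq z < 1 := by nlinarith
    rw [Complex.normSq_eq_norm_sq] at h3
    nlinarith [norm_nonneg z]
  have hanti : ∀ k : ℕ, q ((e M ^ k) x) ≤ q x := by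
    intro k
    induction k with
    | zero => simp
    | succ k ih =>
      refine le_trans ?_ ih
      rw [pow_succ']
      change q (M ((e M ^ k) x)) ≤ _
      rw [hM]
      refine (hle _).trans_eq ?_
      rw [hg']
  have hlim : Tendsto (fun k : ℕ => q ((e M ^ k) x)) atTop (𝓝 (q 0)) := by
    refine (hq.tendsto 0).comp ?_
    have := ((ContinuousLinearMap.apply ℂ V x).continuous.tendsto 0).comp hpow
    rw [map_zero] at this
    exact this
  rw [hq0] at hlim
  exact le_of_tendsto' hlim hanti

/-- The span of the generalized eigenspaces for the eigenvalues in a finite set. -/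
def genEigenspaceSum {V : Type*} [AddCommGroup V] [Module ℂ V] (f : Module.End ℂ V)
    (s : Finset ℂ) : Submodule ℂ V := ⨆ μ ∈ (s : Set ℂ), f.maxGenEigenspace μ

/-- Generalized eigenspaces are used so that dimensions count algebraic multiplicities; they are
independent, so the dimensions add. -/
theorem finrank_genEigenspaceSum {V : Type*} [AddCommGroup V] [Module ℂ V] [FiniteDimensional ℂ V]
    (f : Module.End ℂ V) (s : Finset ℂ) :
    Module.finrank ℂ (genEigenspaceSum f s) = ∑ μ ∈ s, f.charpoly.rootMultiplicity μ := by
  classical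
  induction s using Finset.induction_on with
  | empty =>
    rw [genEigenspaceSum, Finset.coe_empty, iSup_emptyset, finrank_bot, Finset.sum_empty]
  | insert a s ha ih =>
    have h1 : genEigenspaceSum f (insert a s) = f.maxGenEigenspace a ⊔ genEigenspaceSum f s := by
      rw [genEigenspaceSum, Finset.coe_insert, iSup_insert, genEigenspaceSum]
    have h2 : Disjoint (f.maxGenEigenspace a) (genEigenspaceSum f s) :=
      f.independent_maxGenEigenspace.disjoint_biSup (by simpa using ha)
    have h3 := Submodule.finrank_sup_add_finrank_inf_eq (f.maxGenEigenspace a)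
      (genEigenspaceSum f s)
    rw [disjoint_iff.1 h2, finrank_bot, add_zero] at h3
    rw [h1, h3, ih, Finset.sum_insert ha, LinearMap.finrank_maxGenEigenspace_eq]

theorem mapsTo_genEigenspaceSum {V : Type*} [AddCommGroup V] [Module ℂ V]
    (f : Module.End ℂ V) (s : Finset ℂ) {x : V} (hx : x ∈ genEigenspaceSum f s) :
    f x ∈ genEigenspaceSum f s := by
  have : genEigenspaceSum f s ≤ (genEigenspaceSum f s).comap f := by
    conv_lhs => unfold genEigenspaceSum
    refine iSup₂_le fun μ hμ y hy => ?_
    exact Submodule.mem_iSup_of_mem μ (Submodule.mem_iSup_of_mem hμ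
      (Module.End.mapsTo_maxGenEigenspace_of_comm (Commute.refl f) μ hy))
  exact this hx

theorem mem_of_eigenvector_mem_genEigenspaceSum {V : Type*} [AddCommGroup V] [Module ℂ V]
    (f : Module.End ℂ V) (s : Finset ℂ) {x : V} (hx : x ∈ genEigenspaceSum f s) (hx0 : x ≠ 0)
    {μ : ℂ} (hμ : f x = μ • x) : μ ∈ s := by
  by_contra h
  have h2 : Disjoint (f.maxGenEigenspace μ) (genEigenspaceSum f s) :=
    f.independent_maxGenEigenspace.disjoint_biSup (by simpa using h)
  refine hx0 (Submodule.disjoint_def.1 h2 x ?_ hx)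
  exact (f.genEigenspace μ).mono (show (1 : ℕ∞) ≤ ⊤ from le_top) (Module.End.mem_eigenspace_iff.2 hμ)

/-- A subspace on which a diagonal form is nonnegative has at most as many dimensions as the form has
nonnegative coefficients. -/
theorem finrank_le_of_diagonal_nonneg {ι V : Type*} [Fintype ι] [AddCommGroup V] [Module ℂ V]
    (φ : V →ₗ[ℂ] ι → ℂ) (hφ : Function.Injective φ) (d : ι → ℝ) (W : Submodule ℂ V)
    (hW : ∀ x ∈ W, 0 ≤ ∑ i, d i * ‖φ x i‖ ^ 2) :
    Module.finrank ℂ W ≤ (Finset.univ.filter fun i => 0 ≤ d i).card := by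
  classical
  let ψ : W →ₗ[ℂ] ({i // 0 ≤ d i} → ℂ) := LinearMap.funLeft ℂ ℂ Subtype.val ∘ₗ φ ∘ₗ W.subtype
  have hψ : Function.Injective ψ := by
    rw [← LinearMap.ker_eq_bot, LinearMap.ker_eq_bot']
    rintro ⟨x, hx⟩ h0
    have hz : ∀ i, 0 ≤ d i → φ x i = 0 := fun i hi => congr_fun h0 ⟨i, hi⟩
    have hle : ∀ i ∈ Finset.univ, d i * ‖φ x i‖ ^ 2 ≤ 0 := by
      intro i _
      by_cases hi : 0 ≤ d i
      · simp [hz i hi]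
      · exact mul_nonpos_of_nonpos_of_nonneg (not_le.1 hi).le (by positivity)
    have hsum := (Finset.sum_eq_zero_iff_of_nonpos hle).1
      (le_antisymm (Finset.sum_nonpos hle) (hW x hx))
    have : φ x = 0 := by
      funext i
      by_cases hi : 0 ≤ d i
      · exact hz i hi
      · have h := hsum i (Finset.mem_univ i)
        have hi' : d i ≠ 0 := fun h => hi h.ge
        simpa [hi'] using h
    exact Subtype.ext (hφ (by simpa using this))
  have := LinearMap.finrank_le_finrank_of_injective hψ
  rwa [Module.finrank_fintype_fun_eq_card, Fintype.card_subtype] at this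

end Lyapunov

/-! ### Hermitian forms and the inertia theorem. -/

section Inertia

/-- A real matrix seen as a complex matrix. -/
abbrev complexify {m n : Type*} (M : Matrix m n ℝ) : Matrix m n ℂ := M.map (algebraMap ℝ ℂ)

theorem isHermitian_complexify {n : Type*} {P : Matrix n n ℝ} (hP : P.IsSymm) :
    (complexify P).IsHermitian := by
  ext i j
  simp [conjTranspose_apply, hP.apply]

theorem complexEigenvalues_of_isSymm {n : ℕ} {P : Matrix (Fin n) (Fin n) ℝ} (hP : P.IsSymm) :
    complexEigenvalues P = Finset.univ.val.map
      (fun i => ((isHermitian_complexify hP).eigenvalues i : ℂ)) :=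
  (isHermitian_complexify hP).roots_charpoly_eq_eigenvalues

theorem re_dotProduct_mulVec_eq_sum {n : Type*} [Fintype n] [DecidableEq n] {M : Matrix n n ℂ}
    (hM : M.IsHermitian) (x : n → ℂ) :
    (star x ⬝ᵥ M *ᵥ x).re =
      ∑ i, hM.eigenvalues i * ‖toLin' (hM.eigenvectorUnitary : Matrix n n ℂ)ᴴ x i‖ ^ 2 := by
  set U : Matrix n n ℂ := (hM.eigenvectorUnitary : Matrix n n ℂ)
  have h1 : M = U * diagonal (RCLike.ofReal ∘ hM.eigenvalues) * Uᴴ := by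
    conv_lhs => rw [hM.spectral_theorem]
    rw [Unitary.conjStarAlgAut_apply]
    rfl
  have h2 : star x ⬝ᵥ M *ᵥ x =
      star (Uᴴ *ᵥ x) ⬝ᵥ (diagonal (RCLike.ofReal ∘ hM.eigenvalues) *ᵥ (Uᴴ *ᵥ x)) := by
    conv_lhs => rw [h1]
    rw [← mulVec_mulVec, ← mulVec_mulVec, star_mulVec, conjTranspose_conjTranspose,
      ← dotProduct_mulVec]
  rw [h2, dotProduct, Complex.re_sum]
  refine Finset.sum_congr rfl fun i _ => ?_
  rw [mulVec_diagonal, toLin'_apply, ← Complex.normSq_eq_norm_sq, Complex.normSq_apply]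
  simp
  ring

/-- Half of Sylvester's law of inertia for each sign: in eigenvector coordinates the form is
diagonal. -/
theorem finrank_le_of_nonneg_form {n : ℕ} {M : Matrix (Fin n) (Fin n) ℂ} (hM : M.IsHermitian)
    (W : Submodule ℂ (Fin n → ℂ)) :
    ((∀ x ∈ W, 0 ≤ (star x ⬝ᵥ M *ᵥ x).re) →
      Module.finrank ℂ W ≤ (Finset.univ.filter fun i => 0 ≤ hM.eigenvalues i).card) ∧
    ((∀ x ∈ W, (star x ⬝ᵥ M *ᵥ x).re ≤ 0) →
      Module.finrank ℂ W ≤ (Finset.univ.filter fun i => hM.eigenvalues i ≤ 0).card) := by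
  have hinj : Function.Injective (toLin' (hM.eigenvectorUnitary : Matrix (Fin n) (Fin n) ℂ)ᴴ) := by
    intro x y hxy
    have := congrArg ((hM.eigenvectorUnitary : Matrix (Fin n) (Fin n) ℂ) *ᵥ ·) hxy
    have hu : (hM.eigenvectorUnitary : Matrix (Fin n) (Fin n) ℂ) *
        (hM.eigenvectorUnitary : Matrix (Fin n) (Fin n) ℂ)ᴴ = 1 :=
      Unitary.mul_star_self_of_mem hM.eigenvectorUnitary.2
    simpa [toLin'_apply, mulVec_mulVec, hu] using this
  constructor
  · intro h
    exact finrank_le_of_diagonal_nonneg _ hinj _ W fun x hx => by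
      rw [← re_dotProduct_mulVec_eq_sum hM]; exact h x hx
  · intro h
    have := finrank_le_of_diagonal_nonneg _ hinj (fun i => -hM.eigenvalues i) W fun x hx => by
      have h2 := h x hx
      rw [re_dotProduct_mulVec_eq_sum hM] at h2
      simpa [neg_mul, Finset.sum_neg_distrib] using h2
    simpa using this

/-- Turns a Lyapunov inequality, a sign of `Re x* M f x`, into the monotonicity from `x - f x` to `x
+ f x` required by `nonneg_of_stable`. -/
theorem hermitian_form_sub {n : Type*} [Fintype n] {M : Matrix n n ℂ} (hM : M.IsHermitian)
    (x y : n → ℂ) :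
    (star (x + y) ⬝ᵥ M *ᵥ (x + y)).re - (star (x - y) ⬝ᵥ M *ᵥ (x - y)).re =
      4 * (star x ⬝ᵥ M *ᵥ y).re := by
  have h : (star y ⬝ᵥ M *ᵥ x).re = (star x ⬝ᵥ M *ᵥ y).re := by
    have : star (star y ⬝ᵥ M *ᵥ x) = star x ⬝ᵥ M *ᵥ y := by
      rw [← star_dotProduct_star, star_star, star_mulVec, hM.eq, dotProduct_mulVec]
    rw [← this]
    simp
  simp only [star_add, star_sub, mulVec_add, mulVec_sub, add_dotProduct, sub_dotProduct,
    dotProduct_add, dotProduct_sub, Complex.add_re, Complex.sub_re, h]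
  ring

theorem sum_rootMultiplicity_filter (p : Polynomial ℂ) (q : ℂ → Prop) [DecidablePred q] :
    ∑ μ ∈ p.roots.toFinset.filter q, p.rootMultiplicity μ = p.roots.countP q := by
  classical
  rw [Multiset.countP_eq_card_filter, ← Multiset.toFinset_sum_count_eq, Multiset.toFinset_filter]
  refine Finset.sum_congr rfl fun μ hμ => ?_
  rw [Multiset.count_filter_of_pos (Finset.mem_filter.1 hμ).2, Polynomial.count_roots]

/-- The inertia theorem: if `P` solves a (nonstrict) Lyapunov inequality for `A + r`, which has no
eigenvalues on the imaginary axis, and `P` is nonsingular, then the number of negative eigenvalues of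
`P` is that of unstable eigenvalues of `A + r`. -/
theorem countP_neg_eq_of_lyapunov {n : ℕ} {A P : Matrix (Fin n) (Fin n) ℝ} {r : ℝ} (hP : P.IsSymm)
    (h0 : (complexEigenvalues P).countP (fun z => z.re = 0) = 0)
    (hA : ∀ z ∈ complexEigenvalues A, z.re ≠ -r)
    (hL : ∀ x : Fin n → ℂ,
      (star x ⬝ᵥ complexify P *ᵥ (complexify A *ᵥ x + (r : ℂ) • x)).re ≤ 0) :
    (complexEigenvalues P).countP (fun z => z.re < 0) =
      (complexEigenvalues A).countP (fun z => -r < z.re) := by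
  classical
  have hH := isHermitian_complexify hP
  set f : Module.End ℂ (Fin n → ℂ) := toLin' (complexify A) with hf
  set roots := complexEigenvalues A with hroots
  have hchar : f.charpoly.roots = roots := by rw [hf, charpoly_toLin']; rfl
  -- signs of the form on the two spectral subspaces
  have key : ∀ (s : Finset ℂ) (σ : ℝ), (σ = 1 ∨ σ = -1) → (∀ μ ∈ s, σ * (μ.re + r) < 0) →
      ∀ x ∈ genEigenspaceSum f s, 0 ≤ σ * (star x ⬝ᵥ complexify P *ᵥ x).re := by
    intro s σ hσ hs x hx
    set W := genEigenspaceSum f s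
    have hσσ : σ * σ = 1 := by rcases hσ with h | h <;> rw [h] <;> norm_num
    -- On `W` the map `σ (A + r)` is stable. The form `σ P` does not increase along it, because the
    -- two signs multiply to `σ ^ 2 = 1`; so both spectral subspaces are handled at once.
    let g : Module.End ℂ W := (σ : ℂ) • (f.restrict (p := W) (q := W)
      (fun y hy => mapsTo_genEigenspaceSum f s hy) + (r : ℂ) • 1)
    have hg : ∀ y : W, (g y : Fin n → ℂ) =
        (σ : ℂ) • (complexify A *ᵥ (y : Fin n → ℂ) + (r : ℂ) • (y : Fin n → ℂ)) := fun y => rfl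
    refine nonneg_of_stable g ?_ (fun y : W => σ * (star (y : Fin n → ℂ) ⬝ᵥ
      complexify P *ᵥ (y : Fin n → ℂ)).re) ?_ (by simp) ?_ ⟨x, hx⟩
    · intro μ hμ
      obtain ⟨v, hv, hv0⟩ := hμ.exists_hasEigenvector
      have hv' := congrArg (Subtype.val) (Module.End.mem_eigenspace_iff.1 hv)
      rw [hg] at hv'
      have hv'' : f (v : Fin n → ℂ) = ((σ : ℂ) * μ - r) • (v : Fin n → ℂ) := by
        have h1 := congrArg ((σ : ℂ) • ·) hv'
        have h2 : (σ : ℂ) * σ = 1 := by exact_mod_cast hσσ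
        simp only [smul_smul, h2, one_smul, Submodule.coe_smul] at h1
        rw [hf, toLin'_apply, sub_smul, ← h1]
        simp
      have := hs _ (mem_of_eigenvector_mem_genEigenspaceSum f s v.2
        (fun h => hv0 (Subtype.ext h)) hv'')
      simp at this
      nlinarith
    · fun_prop
    · intro y
      have h1 := hermitian_form_sub hH (y : Fin n → ℂ) (g y)
      have h2 := hL (y : Fin n → ℂ)
      have h3 : (star (y : Fin n → ℂ) ⬝ᵥ complexify P *ᵥ (g y : Fin n → ℂ)).re =
          σ * (star (y : Fin n → ℂ) ⬝ᵥ complexify P *ᵥ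
            (complexify A *ᵥ (y : Fin n → ℂ) + (r : ℂ) • (y : Fin n → ℂ))).re := by
        rw [hg, mulVec_smul, dotProduct_smul]
        simp
      rw [h3] at h1
      simp only [Submodule.coe_add, Submodule.coe_sub]
      have h4 := congrArg (σ * ·) h1
      simp only [mul_sub] at h4
      rw [show ∀ c : ℝ, σ * (4 * (σ * c)) = 4 * c from fun c => by
        linear_combination 4 * c * hσσ] at h4
      linarith
  have hcard : roots.card = n := by
    rw [← hchar, IsAlgClosed.card_roots_eq_natDegree, LinearMap.charpoly_natDegree]
    simp
  have hsplit : roots.countP (fun z => z.re < -r) + roots.countP (fun z => -r < z.re) = n := by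
    rw [← hcard, roots.card_eq_countP_add_countP (fun z => z.re < -r)]
    congr 1
    refine Multiset.countP_congr rfl fun z hz => ?_
    have := hA z hz
    simp only [not_lt, eq_iff_iff]
    exact ⟨le_of_lt, fun h => lt_of_le_of_ne h this.symm⟩
  have hm := (finrank_le_of_nonneg_form hH
    (genEigenspaceSum f (f.charpoly.roots.toFinset.filter fun z => z.re < -r))).1 (by
      intro x hx
      have := key _ 1 (Or.inl rfl) (by
        intro μ hμ
        have := (Finset.mem_filter.1 hμ).2
        linarith) x hx
      linarith)
  have hp := (finrank_le_of_nonneg_form hH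
    (genEigenspaceSum f (f.charpoly.roots.toFinset.filter fun z => -r < z.re))).2 (by
      intro x hx
      have := key _ (-1) (Or.inr rfl) (by
        intro μ hμ
        have := (Finset.mem_filter.1 hμ).2
        linarith) x hx
      linarith)
  rw [finrank_genEigenspaceSum, sum_rootMultiplicity_filter, hchar] at hm hp
  have hne : ∀ i, hH.eigenvalues i ≠ 0 := by
    rw [complexEigenvalues_of_isSymm hP, Multiset.countP_eq_zero] at h0
    intro i hi
    exact h0 _ (Multiset.mem_map_of_mem _ (Finset.mem_univ i)) (by simp [hi])
  have hneg : (complexEigenvalues P).countP (fun z => z.re < 0) =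
      (Finset.univ.filter fun i => hH.eigenvalues i ≤ 0).card := by
    rw [complexEigenvalues_of_isSymm hP, Multiset.countP_map]
    congr 1
    refine Multiset.filter_congr fun i _ => ?_
    simp [le_iff_lt_or_eq, hne i]
  have htot : (Finset.univ.filter fun i => 0 ≤ hH.eigenvalues i).card +
      (Finset.univ.filter fun i => hH.eigenvalues i ≤ 0).card = n := by
    have := Finset.card_filter_add_card_filter_not (s := Finset.univ) (fun i => 0 ≤ hH.eigenvalues i)
    rw [Finset.card_univ, Fintype.card_fin] at this
    refine Eq.trans ?_ this
    congr 2
    ext i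
    simp only [Finset.mem_filter, Finset.mem_univ, true_and, not_le]
    exact ⟨fun h => lt_of_le_of_ne h (hne i), le_of_lt⟩
  -- The stable count is at most the number of positive eigenvalues of `P`, the unstable count at
  -- most that of negative ones. Both pairs add up to `n`, so equality holds in each.
  rw [hneg]
  omega

end Inertia

/-! ### Equivalence of the conic constraint and the matrix inequality. -/

section LMI

theorem exists_conjTranspose_mul_self {m : Type*} [Fintype m] [DecidableEq m] {Z : Matrix m m ℝ}
    (hZ : Z.PosSemidef) : ∃ W : Matrix m m ℝ, Z = Wᵀ * W := by
  open scoped MatrixOrder in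
  obtain ⟨B, rfl⟩ := CStarAlgebra.nonneg_iff_eq_star_mul_self.mp hZ.nonneg
  exact ⟨B, by rw [star_eq_conjTranspose, conjTranspose_eq_transpose_of_trivial]⟩

theorem conjTranspose_complexify {m n : Type*} (M : Matrix m n ℝ) :
    (complexify M)ᴴ = complexify Mᵀ := by
  ext i j
  simp [conjTranspose_apply]

theorem re_dotProduct_self {m : Type*} [Fintype m] (v : m → ℂ) :
    (star v ⬝ᵥ v).re = ∑ i, ‖v i‖ ^ 2 := by
  simp [dotProduct, Complex.re_sum, ← Complex.normSq_eq_norm_sq, Complex.normSq_apply]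

/-- With `Z = Wᵀ W` the form is `‖W w‖²` for complex `w` too. This carries the real matrix
inequality over to the complex states of the frequency domain. -/
theorem re_dotProduct_complexify_nonneg {m : Type*} [Fintype m] [DecidableEq m] {Z : Matrix m m ℝ}
    (hZ : Z.PosSemidef) (w : m → ℂ) : 0 ≤ (star w ⬝ᵥ complexify Z *ᵥ w).re := by
  obtain ⟨W, rfl⟩ := exists_conjTranspose_mul_self hZ
  have : complexify (Wᵀ * W) = (complexify W)ᴴ * complexify W := by
    rw [conjTranspose_complexify]
    exact Matrix.map_mul
  rw [this, ← mulVec_mulVec, dotProduct_mulVec, ← star_mulVec, re_dotProduct_self]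
  positivity

/-- The quadratic form of the block matrix of the linear matrix inequality. -/
theorem lmi_form {𝕜 m k l : Type*} [CommRing 𝕜] [StarRing 𝕜] [Fintype m] [Fintype k] [Fintype l]
    [DecidableEq m] [DecidableEq k]
    (A P : Matrix m m 𝕜) (B : Matrix m k 𝕜) (C : Matrix l m 𝕜) (D : Matrix l k 𝕜) (r ε g : 𝕜)
    (x : m → 𝕜) (u : k → 𝕜) :
    star (Sum.elim x u) ⬝ᵥ (fromBlocks (Aᴴ * P + P * A + r • P + ε • (1 : Matrix m m 𝕜) + Cᴴ * C)
      (P * B + Cᴴ * D) (Bᴴ * P + Dᴴ * C) (-(g • (1 : Matrix k k 𝕜)) + Dᴴ * D) *ᵥ Sum.elim x u) =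
    star (A *ᵥ x + B *ᵥ u) ⬝ᵥ P *ᵥ x + star x ⬝ᵥ P *ᵥ (A *ᵥ x + B *ᵥ u) + r * (star x ⬝ᵥ P *ᵥ x) +
      ε * (star x ⬝ᵥ x) + star (C *ᵥ x + D *ᵥ u) ⬝ᵥ (C *ᵥ x + D *ᵥ u) - g * (star u ⬝ᵥ u) := by
  have hs : star (Sum.elim x u) = Sum.elim (star x) (star u) := by
    funext i
    cases i <;> rfl
  rw [hs, fromBlocks_mulVec, dotProduct, Fintype.sum_sum_type]
  simp only [Sum.elim_inl, Sum.elim_inr, Sum.elim_comp_inl, Sum.elim_comp_inr]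
  change star x ⬝ᵥ _ + star u ⬝ᵥ _ = _
  simp only [add_mulVec, mulVec_add, ← mulVec_mulVec, smul_mulVec, one_mulVec, neg_mulVec,
    dotProduct_add, star_add, add_dotProduct, star_mulVec, ← dotProduct_mulVec, dotProduct_smul,
    dotProduct_neg, smul_eq_mul]
  ring

namespace LTISystem

variable {n : ℕ} (S : LTISystem n)

theorem complexify_lmiMatrix (r γ ε : ℝ) (P : Matrix (Fin n) (Fin n) ℝ) :
    complexify (S.lmiMatrix r γ ε P) =
      fromBlocks ((complexify S.A)ᴴ * complexify P + complexify P * complexify S.A +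
          ((2 * r : ℝ) : ℂ) • complexify P + (ε : ℂ) • (1 : Matrix (Fin n) (Fin n) ℂ) +
          (complexify S.C)ᴴ * complexify S.C)
        (complexify P * complexify S.B + (complexify S.C)ᴴ * complexify S.D)
        ((complexify S.B)ᴴ * complexify P + (complexify S.D)ᴴ * complexify S.C)
        (-(((γ ^ 2 : ℝ) : ℂ) • (1 : Matrix (Fin 1) (Fin 1) ℂ)) +
          (complexify S.D)ᴴ * complexify S.D) := by
  simp only [conjTranspose_complexify]
  rw [complexify, lmiMatrix, fromBlocks_map]
  congr 1 <;> ext i j <;> simp [mul_apply, Matrix.one_apply, apply_ite]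

theorem isHermitian_lmiMatrix (r γ ε : ℝ) {P : Matrix (Fin n) (Fin n) ℝ} (hP : P.IsSymm) :
    (S.lmiMatrix r γ ε P).IsHermitian := by
  rw [IsHermitian, conjTranspose_eq_transpose_of_trivial, lmiMatrix, fromBlocks_transpose]
  congr 1 <;>
  simp only [transpose_add, transpose_mul, transpose_smul, transpose_neg, transpose_one,
    transpose_transpose, hP.eq]
  rw [add_comm (P * S.A)]

theorem lmi_form_real (r γ ε : ℝ) (P : Matrix (Fin n) (Fin n) ℝ) (hP : P.IsSymm) (x : Fin n → ℝ)
    (u : Fin 1 → ℝ) :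
    Sum.elim x u ⬝ᵥ (S.lmiMatrix r γ ε P *ᵥ Sum.elim x u) =
      2 * (x ⬝ᵥ P *ᵥ (S.A *ᵥ x + S.B *ᵥ u)) + 2 * r * (x ⬝ᵥ P *ᵥ x) + ε * (x ⬝ᵥ x) +
        (S.C *ᵥ x + S.D *ᵥ u) ⬝ᵥ (S.C *ᵥ x + S.D *ᵥ u) - γ ^ 2 * (u ⬝ᵥ u) := by
  have h := lmi_form S.A P S.B S.C S.D (2 * r) ε (γ ^ 2) x u
  simp only [conjTranspose_eq_transpose_of_trivial, star_trivial] at h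
  rw [lmiMatrix, h]
  have : (S.A *ᵥ x + S.B *ᵥ u) ⬝ᵥ P *ᵥ x = x ⬝ᵥ P *ᵥ (S.A *ᵥ x + S.B *ᵥ u) := by
    rw [dotProduct_mulVec, ← mulVec_transpose, hP.eq, dotProduct_comm]
  rw [this]
  ring

theorem neg_lmiMatrix_posSemidef_iff (r γ ε : ℝ) {P : Matrix (Fin n) (Fin n) ℝ} (hP : P.IsSymm) :
    (-(S.lmiMatrix r γ ε P)).PosSemidef ↔ ∀ (x : Fin n → ℝ) (u : Fin 1 → ℝ),
      2 * (x ⬝ᵥ P *ᵥ (S.A *ᵥ x + S.B *ᵥ u)) + 2 * r * (x ⬝ᵥ P *ᵥ x) + ε * (x ⬝ᵥ x) +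
        (S.C *ᵥ x + S.D *ᵥ u) ⬝ᵥ (S.C *ᵥ x + S.D *ᵥ u) - γ ^ 2 * (u ⬝ᵥ u) ≤ 0 := by
  rw [posSemidef_iff_dotProduct_mulVec]
  constructor
  · intro h x u
    have := h.2 (Sum.elim x u)
    rw [star_trivial, neg_mulVec, dotProduct_neg, S.lmi_form_real r γ ε P hP] at this
    linarith
  · refine fun h => ⟨(S.isHermitian_lmiMatrix r γ ε hP).neg, fun w => ?_⟩
    have := h (w ∘ Sum.inl) (w ∘ Sum.inr)
    rw [← S.lmi_form_real r γ ε P hP, Sum.elim_comp_inl_inr] at this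
    rw [star_trivial, neg_mulVec, dotProduct_neg]
    linarith

/-- Every state and every input value occur on a trajectory. -/
theorem exists_isTrajectory (x₀ : Fin n → ℝ) (u₀ : Fin 1 → ℝ) :
    ∃ x u y, S.IsTrajectory x u y ∧ x 0 = x₀ ∧ u 0 = u₀ := by
  let E := (Fin n → ℝ) × (Fin 1 → ℝ)
  -- A constant input, adjoined to the state with zero derivative, makes the system autonomous; its
  -- flow is `exp (t T)`.
  let T : E →L[ℝ] E := LinearMap.toContinuousLinearMap
    ((S.A.mulVecLin ∘ₗ LinearMap.fst ℝ _ _ + S.B.mulVecLin ∘ₗ LinearMap.snd ℝ _ _).prod 0)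
  let z : ℝ → E := fun t => NormedSpace.exp (t • T) (x₀, u₀)
  have hz : ∀ t, HasDerivAt z (T (z t)) t := fun t => by
    have h := (hasDerivAt_exp_smul_const' (𝕂 := ℝ) T t)
    have h2 := (ContinuousLinearMap.apply ℝ E (x₀, u₀)).hasFDerivAt.comp_hasDerivAt t h
    exact h2
  have hu : ∀ t, (z t).2 = u₀ := by
    have hd : ∀ t, HasDerivAt (fun t => (z t).2) 0 t := fun t => by
      have h2 := (ContinuousLinearMap.snd ℝ (Fin n → ℝ) (Fin 1 → ℝ)).hasFDerivAt.comp_hasDerivAt t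
        (hz t)
      exact h2
    intro t
    have := is_const_of_deriv_eq_zero (fun t => (hd t).differentiableAt) (fun t => (hd t).deriv) t 0
    rw [this]
    simp [z]
  refine ⟨fun t => (z t).1, fun _ => u₀, fun t => S.C *ᵥ (z t).1 + S.D *ᵥ u₀,
    fun t => ⟨?_, rfl⟩, by simp [z], rfl⟩
  have h2 := (ContinuousLinearMap.fst ℝ (Fin n → ℝ) (Fin 1 → ℝ)).hasFDerivAt.comp_hasDerivAt t
    (hz t)
  have h3 : (T (z t)).1 = S.A *ᵥ (z t).1 + S.B *ᵥ u₀ := by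
    conv_rhs => rw [← hu t]
    rfl
  rw [← h3]
  exact h2

/-- At any time `x'` and `y` are determined by `x` and `u`, and every pair `(x, u)` occurs at time
zero of some trajectory. -/
theorem conicConstraint_iff (r γ ε : ℝ) {P : Matrix (Fin n) (Fin n) ℝ} (hP : P.IsSymm) :
    S.ConicConstraint r γ ε P ↔ (-(S.lmiMatrix r γ ε P)).PosSemidef := by
  rw [S.neg_lmiMatrix_posSemidef_iff r γ ε hP]
  have hL : ∀ v x : Fin n → ℝ, Sum.elim v x ⬝ᵥ
      (fromBlocks 0 P P ((2 * r) • P + ε • (1 : Matrix (Fin n) (Fin n) ℝ)) *ᵥ Sum.elim v x) =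
      2 * (x ⬝ᵥ P *ᵥ v) + 2 * r * (x ⬝ᵥ P *ᵥ x) + ε * (x ⬝ᵥ x) := by
    intro v x
    have : v ⬝ᵥ P *ᵥ x = x ⬝ᵥ P *ᵥ v := by
      rw [dotProduct_mulVec, ← mulVec_transpose, hP.eq, dotProduct_comm]
    rw [fromBlocks_mulVec, sumElim_dotProduct_sumElim]
    simp only [Sum.elim_comp_inl, Sum.elim_comp_inr, zero_mulVec, zero_add, dotProduct_add,
      add_mulVec, smul_mulVec, one_mulVec, dotProduct_smul, smul_eq_mul, this]
    ring
  have hR : ∀ y u : Fin 1 → ℝ, Sum.elim y u ⬝ᵥ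
      (fromBlocks (-1) 0 0 (γ ^ 2 • (1 : Matrix (Fin 1) (Fin 1) ℝ)) *ᵥ Sum.elim y u) =
      γ ^ 2 * (u ⬝ᵥ u) - y ⬝ᵥ y := by
    intro y u
    rw [fromBlocks_mulVec, sumElim_dotProduct_sumElim]
    simp only [Sum.elim_comp_inl, Sum.elim_comp_inr, zero_mulVec, zero_add, add_zero, neg_mulVec,
      smul_mulVec, one_mulVec, dotProduct_smul, smul_eq_mul, dotProduct_neg]
    ring
  constructor
  · intro h x₀ u₀
    obtain ⟨x, u, y, ht, rfl, rfl⟩ := S.exists_isTrajectory x₀ u₀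
    have := h x u y ht 0
    rw [hL, hR, (ht 0).1.deriv, (ht 0).2] at this
    linarith
  · intro h x u y ht t
    have := h (x t) (u t)
    rw [hL, hR, (ht t).1.deriv, (ht t).2]
    linarith

theorem hasGain_iff_lmiSolvable (p : ℕ) (r : ℝ) (γ : ℝ≥0) :
    S.HasGain p r γ ↔ S.LMISolvable p r γ :=
  exists_congr fun ε => and_congr_right fun _ => exists_congr fun _ => and_congr_right fun hP =>
    and_congr_right fun _ => S.conicConstraint_iff r γ ε hP

/-- The linear matrix inequality for complex states and inputs. -/
theorem complex_form_nonpos {r γ ε : ℝ} {P : Matrix (Fin n) (Fin n) ℝ} (hP : P.IsSymm)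
    (h : (-(S.lmiMatrix r γ ε P)).PosSemidef) (x : Fin n → ℂ) (u : Fin 1 → ℂ) :
    2 * (star x ⬝ᵥ complexify P *ᵥ
        (complexify S.A *ᵥ x + complexify S.B *ᵥ u + (r : ℂ) • x)).re +
      ε * (star x ⬝ᵥ x).re + ‖(complexify S.C *ᵥ x + complexify S.D *ᵥ u) 0‖ ^ 2 -
      γ ^ 2 * ‖u 0‖ ^ 2 ≤ 0 := by
  have h1 := re_dotProduct_complexify_nonneg h (Sum.elim x u)
  have h2 : complexify (-(S.lmiMatrix r γ ε P)) = -complexify (S.lmiMatrix r γ ε P) := by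
    ext i j
    simp
  rw [h2, neg_mulVec, dotProduct_neg, complexify_lmiMatrix, lmi_form] at h1
  set v := complexify S.A *ᵥ x + complexify S.B *ᵥ u
  have h3 : (star v ⬝ᵥ complexify P *ᵥ x).re = (star x ⬝ᵥ complexify P *ᵥ v).re := by
    have : star (star v ⬝ᵥ complexify P *ᵥ x) = star x ⬝ᵥ complexify P *ᵥ v := by
      rw [← star_dotProduct_star, star_star, star_mulVec, (isHermitian_complexify hP).eq,
        dotProduct_mulVec]
    rw [← this]
    simp
  have h4 : ∀ w : Fin 1 → ℂ, (star w ⬝ᵥ w).re = ‖w 0‖ ^ 2 := fun w => by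
    simp [re_dotProduct_self]
  simp only [Complex.neg_re, Complex.sub_re, Complex.add_re,
    Complex.re_ofReal_mul, h3, h4] at h1
  rw [mulVec_add, dotProduct_add, mulVec_smul, dotProduct_smul, smul_eq_mul, Complex.add_re,
    Complex.re_ofReal_mul]
  linarith

end LTISystem

end LMI

/-! ### Diagonalization of unitaries and of skew pairs. -/

section SpectralUnitary

variable {E E' : Type*} [NormedAddCommGroup E] [InnerProductSpace ℂ E] [FiniteDimensional ℂ E]
  [NormedAddCommGroup E'] [InnerProductSpace ℂ E'] [FiniteDimensional ℂ E']

open Module (finrank)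

theorem exists_norm_eq_one_not_hasEigenvalue (f : Module.End ℂ E) :
    ∃ c : ℂ, ‖c‖ = 1 ∧ ¬ f.HasEigenvalue c := by
  have hinf : (Metric.sphere (0 : ℂ) 1).Infinite :=
    (isPreconnected_sphere (by rw [Complex.rank_real_complex]; norm_num) 0 1).infinite_of_nontrivial
      ⟨1, by simp, -1, by simp, by norm_num⟩
  obtain ⟨c, hc, hc'⟩ := hinf.exists_notMem_finite (Module.End.finite_hasEigenvalue f)
  exact ⟨c, by simpa using hc, hc'⟩

/-- A linear isometry of a finite-dimensional complex inner product space onto itself has an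
orthonormal basis of eigenvectors (by way of its Cayley transform). -/
theorem LinearIsometry.exists_eigenbasis (Q : E →ₗᵢ[ℂ] E) :
    ∃ b : OrthonormalBasis (Fin (finrank ℂ E)) ℂ E, ∀ i, ∃ μ : ℂ, ‖μ‖ = 1 ∧ Q (b i) = μ • b i := by
  obtain ⟨c, hc1, hc⟩ := exists_norm_eq_one_not_hasEigenvalue (Q.toLinearMap : Module.End ℂ E)
  have hcc : (starRingEnd ℂ) c * c = 1 := by
    rw [← Complex.normSq_eq_conj_mul_self, Complex.normSq_eq_norm_sq, hc1]; simp
  let R : Module.End ℂ E := c • 1 - Q.toLinearMap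
  have hR : ∀ x, R x = c • x - Q x := fun x => rfl
  have hinj : Function.Injective R := by
    rw [← LinearMap.ker_eq_bot, LinearMap.ker_eq_bot']
    intro v hv
    by_contra hne
    exact hc (Module.End.hasEigenvalue_of_hasEigenvector (x := v)
      ⟨Module.End.mem_eigenspace_iff.2 (sub_eq_zero.1 hv).symm, hne⟩)
  let e := LinearEquiv.ofInjectiveEndo R hinj
  have he : ∀ x, e x = c • x - Q x := hR
  -- `H = i (c + Q)(c - Q)⁻¹` is symmetric because `|c| = 1`. A real eigenvalue `h` of `H` gives
  -- back the eigenvalue `c (h - i) / (h + i)` of `Q`.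
  let H : E →ₗ[ℂ] E := Complex.I • ((c • 1 + Q.toLinearMap) ∘ₗ e.symm.toLinearMap)
  have hH : ∀ x, H (e x) = Complex.I • (c • x + Q x) := fun x => by
    simp [H]
  have hsym : H.IsSymmetric := by
    intro x y
    obtain ⟨x, rfl⟩ := e.surjective x
    obtain ⟨y, rfl⟩ := e.surjective y
    rw [hH, hH, he, he]
    simp only [inner_smul_left, inner_smul_right, inner_add_left, inner_add_right, inner_sub_left,
      inner_sub_right, Q.inner_map_map, Complex.conj_I]
    linear_combination (-2 * Complex.I * inner ℂ x y) * hcc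
  refine ⟨hsym.eigenvectorBasis rfl, fun i => ?_⟩
  set q := hsym.eigenvectorBasis rfl i with hq
  set h := hsym.eigenvalues rfl i
  have hq1 : ‖q‖ = 1 := (hsym.eigenvectorBasis rfl).orthonormal.1 i
  have hHq : H q = (h : ℂ) • q := hsym.apply_eigenvectorBasis rfl i
  obtain ⟨a, ha⟩ := e.surjective q
  rw [← ha, hH, he] at hHq
  have hden : (h : ℂ) + Complex.I ≠ 0 := fun h0 => by
    have := congrArg Complex.im h0
    simp at this
  have hQa : Q a = (((h : ℂ) + Complex.I)⁻¹ * ((h - Complex.I) * c)) • a := by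
    have h1 : ((h : ℂ) + Complex.I) • Q a = ((h - Complex.I) * c) • a := by
      linear_combination (norm := module) hHq
    rw [mul_smul, ← h1, smul_smul, inv_mul_cancel₀ hden, one_smul]
  set ν := ((h : ℂ) + Complex.I)⁻¹ * ((h - Complex.I) * c)
  have hQq : Q q = ν • q := by
    rw [← ha, he, map_sub, map_smul, hQa, smul_sub, map_smul, hQa, smul_comm]
  refine ⟨ν, ?_, hQq⟩
  have := Q.norm_map q
  rw [hQq, norm_smul, hq1, mul_one] at this
  exact this

/-- Linear maps with equal norms at every point differ by an isometry. -/
theorem exists_linearIsometry_of_norm_eq (X Y : E' →ₗ[ℂ] E) (h : ∀ z, ‖X z‖ = ‖Y z‖) :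
    ∃ Q : E →ₗᵢ[ℂ] E, ∀ z, Q (Y z) = X z := by
  obtain ⟨g, hg⟩ := LinearMap.exists_rightInverse_of_surjective Y.rangeRestrict
    Y.range_rangeRestrict
  have hg' : ∀ y : LinearMap.range Y, Y (g y) = y := fun y =>
    congrArg Subtype.val (LinearMap.congr_fun hg y)
  -- `X ∘ g` is isometric on the range of `Y`, as `‖X (g y)‖ = ‖Y (g y)‖ = ‖y‖`. The choice of the
  -- section `g` is immaterial, since `X` and `Y` have the same kernel.
  let L : LinearMap.range Y →ₗᵢ[ℂ] E := ⟨X ∘ₗ g, fun y => by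
    rw [LinearMap.comp_apply, h, hg']; rfl⟩
  refine ⟨L.extend, fun z => ?_⟩
  have h1 := L.extend_apply (Y.rangeRestrict z)
  have h2 : X (g (Y.rangeRestrict z)) = X z := by
    rw [← sub_eq_zero, ← map_sub, ← norm_eq_zero, h, map_sub, hg', norm_eq_zero, sub_eq_zero]
    rfl
  exact h1.trans h2

/-- If `F U* + U F* = 0` then, in a suitable orthonormal basis, `F` and `U` differ on each basis
vector by an imaginary factor, or `U` vanishes on it. -/
theorem exists_basis_of_comp_adjoint_skew (F U : E →ₗ[ℂ] E')
    (h : F ∘ₗ LinearMap.adjoint U + U ∘ₗ LinearMap.adjoint F = 0) :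
    ∃ b : OrthonormalBasis (Fin (finrank ℂ E)) ℂ E, ∀ i,
      U (b i) = 0 ∨ ∃ ω : ℝ, F (b i) = (ω * Complex.I) • U (b i) := by
  -- `‖X z‖² - ‖Y z‖²` is twice the inner product of `z` with `(F U* + U F*) z`, which vanishes, so
  -- `X = Q Y` for an isometry `Q`. The basis sought consists of eigenvectors of `Q`.
  let X := LinearMap.adjoint F + LinearMap.adjoint U
  let Y := LinearMap.adjoint F - LinearMap.adjoint U
  have hX : ∀ z, X z = LinearMap.adjoint F z + LinearMap.adjoint U z := fun z => rfl
  have hY : ∀ z, Y z = LinearMap.adjoint F z - LinearMap.adjoint U z := fun z => rfl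
  have hXY : ∀ z, ‖X z‖ = ‖Y z‖ := by
    intro z
    have h1 : inner ℂ (LinearMap.adjoint F z) (LinearMap.adjoint U z) +
        inner ℂ (LinearMap.adjoint U z) (LinearMap.adjoint F z) = 0 := by
      rw [LinearMap.adjoint_inner_left, LinearMap.adjoint_inner_left, ← inner_add_right]
      have := LinearMap.congr_fun h z
      simp only [LinearMap.add_apply, LinearMap.comp_apply, LinearMap.zero_apply] at this
      rw [this, inner_zero_right]
    have h2 : inner ℂ (X z) (X z) = inner ℂ (Y z) (Y z) := by
      rw [hX, hY]
      simp only [inner_add_left, inner_add_right, inner_sub_left, inner_sub_right]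
      linear_combination 2 * h1
    rw [inner_self_eq_norm_sq_to_K, inner_self_eq_norm_sq_to_K] at h2
    have h3 : ‖X z‖ ^ 2 = ‖Y z‖ ^ 2 := by exact_mod_cast h2
    exact (sq_eq_sq₀ (norm_nonneg _) (norm_nonneg _)).1 h3
  obtain ⟨Q, hQ⟩ := exists_linearIsometry_of_norm_eq X Y hXY
  obtain ⟨b, hb⟩ := Q.exists_eigenbasis
  refine ⟨b, fun i => ?_⟩
  obtain ⟨μ, hμ1, hμ⟩ := hb i
  set w := (starRingEnd ℂ) μ with hw
  have hμw : μ * w = 1 := by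
    rw [hw, Complex.mul_conj, Complex.normSq_eq_norm_sq, hμ1]; simp
  have hrel : F (b i) + U (b i) = w • (F (b i) - U (b i)) := by
    refine ext_inner_right ℂ fun z => ?_
    have h1 : inner ℂ (b i) (X z) = μ * inner ℂ (b i) (Y z) := by
      have h2 := Q.inner_map_map (b i) (Y z)
      rw [hQ, hμ, inner_smul_left, ← hw] at h2
      rw [← h2, ← mul_assoc, hμw, one_mul]
    rw [hX, hY, inner_add_right, inner_sub_right] at h1
    simp only [LinearMap.adjoint_inner_right] at h1
    rw [inner_smul_left, inner_add_left, inner_sub_left, h1, hw, Complex.conj_conj]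
  by_cases hw1 : w = 1
  · left
    rw [hw1, one_smul] at hrel
    have h2 : (2 : ℂ) • U (b i) = 0 := by linear_combination (norm := module) hrel
    exact (smul_eq_zero.1 h2).resolve_left two_ne_zero
  · right
    have hne : 1 - w ≠ 0 := sub_ne_zero.2 (Ne.symm hw1)
    -- `hrel` reads `(1 - w) F b = -(1 + w) U b`, and `(1 + w) / (1 - w)` is imaginary because `|w|
    -- = 1`.
    refine ⟨(-((1 - w)⁻¹ * (1 + w))).im, ?_⟩
    have hre : (-((1 - w)⁻¹ * (1 + w))).re = 0 := by
      have hns : Complex.normSq w = 1 := by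
        rw [Complex.normSq_eq_norm_sq, hw, RCLike.norm_conj, hμ1, one_pow]
      rw [Complex.normSq_apply] at hns
      simp only [Complex.neg_re, Complex.mul_re, Complex.inv_re, Complex.inv_im, Complex.sub_re,
        Complex.sub_im, Complex.add_re, Complex.add_im, Complex.one_re, Complex.one_im]
      linear_combination (Complex.normSq (1 - w))⁻¹ * hns
    have hfac : ((-((1 - w)⁻¹ * (1 + w))).im * Complex.I : ℂ) = -((1 - w)⁻¹ * (1 + w)) := by
      apply Complex.ext
      · rw [hre]; simp
      · simp
    rw [hfac]
    have h3 : (1 - w) • F (b i) = -((1 + w) • U (b i)) := by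
      linear_combination (norm := module) hrel
    rw [neg_smul, mul_smul, ← smul_neg, ← h3, smul_smul, inv_mul_cancel₀ hne, one_smul]

end SpectralUnitary

/-! ### The strict Kalman-Yakubovich-Popov lemma by convex separation. -/

section KYP

/-- The sum of the squares of the entries of a real row vector is the sum of the squares of its
products with the vectors of an orthonormal basis. -/
theorem sum_norm_sq_complexify_mulVec {m κ : Type*} [Fintype m] [Fintype κ]
    (b : OrthonormalBasis κ ℂ (EuclideanSpace ℂ m)) (R : Matrix (Fin 1) m ℝ) :
    ∑ i, ‖(complexify R *ᵥ (b i).ofLp) 0‖ ^ 2 = ∑ j, R 0 j ^ 2 := by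
  have h := b.sum_sq_norm_inner_right (WithLp.toLp 2 fun j => (R 0 j : ℂ))
  rw [EuclideanSpace.norm_sq_eq] at h
  simp only [Complex.norm_real, Real.norm_eq_abs, sq_abs] at h
  rw [← h]
  refine Finset.sum_congr rfl fun i _ => ?_
  rw [norm_inner_symm]
  congr 2
  simp [mulVec, dotProduct, PiLp.inner_apply, mul_comm]

/-- The frequency domain inequality for families of vectors whose Gramian is stationary. -/
theorem sum_sq_output_le {n : ℕ} {m : Type*} [Fintype m] [DecidableEq m]
    (A : Matrix (Fin n) (Fin n) ℝ) (B : Matrix (Fin n) (Fin 1) ℝ) (C : Matrix (Fin 1) (Fin n) ℝ)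
    (D : Matrix (Fin 1) (Fin 1) ℝ) {γ : ℝ}
    (hA : ∀ (x : Fin n → ℂ) (ω : ℝ), complexify A *ᵥ x = (ω * Complex.I) • x → x = 0)
    (hG : ∀ (x : Fin n → ℂ) (v : Fin 1 → ℂ) (ω : ℝ),
      complexify A *ᵥ x + complexify B *ᵥ v = (ω * Complex.I) • x →
      ‖(complexify C *ᵥ x + complexify D *ᵥ v) 0‖ ≤ γ * ‖v 0‖)
    (hD : |D 0 0| ≤ γ) (X : Matrix (Fin n) m ℝ) (V : Matrix (Fin 1) m ℝ)
    (h : (A * X + B * V) * Xᵀ + X * (A * X + B * V)ᵀ = 0) :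
    ∑ j, (C * X + D * V) 0 j ^ 2 ≤ γ ^ 2 * ∑ j, V 0 j ^ 2 ∧ (V = 0 → X = 0) := by
  let F := toEuclideanLin (complexify (A * X + B * V))
  let U := toEuclideanLin (complexify X)
  have hF : ∀ w, (F w).ofLp = complexify (A * X + B * V) *ᵥ w.ofLp := fun w => rfl
  have hU : ∀ w, (U w).ofLp = complexify X *ᵥ w.ofLp := fun w => rfl
  have hskew : F ∘ₗ LinearMap.adjoint U + U ∘ₗ LinearMap.adjoint F = 0 := by
    refine LinearMap.ext fun z => ?_
    apply WithLp.ofLp_injective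
    simp only [F, U, ← toEuclideanLin_conjTranspose_eq_adjoint, conjTranspose_complexify]
    have h1 := congrArg complexify h
    have h2 : complexify ((A * X + B * V) * Xᵀ + X * (A * X + B * V)ᵀ) =
        complexify (A * X + B * V) * complexify Xᵀ +
          complexify X * complexify (A * X + B * V)ᵀ := by
      ext i j
      simp [mul_apply]
    have h3 : complexify (0 : Matrix (Fin n) (Fin n) ℝ) = 0 := by
      ext i j
      simp
    rw [h2, h3] at h1
    have h4 := congrArg (· *ᵥ z.ofLp) h1
    simp only [add_mulVec, zero_mulVec, ← mulVec_mulVec] at h4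
    exact h4
  obtain ⟨b, hb⟩ := exists_basis_of_comp_adjoint_skew F U hskew
  have hmul : ∀ {k : ℕ} (M : Matrix (Fin k) (Fin n) ℝ) (N : Matrix (Fin k) (Fin 1) ℝ)
      (w : m → ℂ), complexify (M * X + N * V) *ᵥ w =
        complexify M *ᵥ (complexify X *ᵥ w) + complexify N *ᵥ (complexify V *ᵥ w) := by
    intro k M N w
    rw [mulVec_mulVec, mulVec_mulVec, ← add_mulVec]
    congr 1
    ext i j
    simp [mul_apply]
  have hFb : ∀ i, (∃ ω : ℝ, (F (b i)).ofLp = (ω * Complex.I) • (U (b i)).ofLp) ∨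
      (U (b i)).ofLp = 0 := fun i => by
    rcases hb i with h0 | ⟨ω, hω⟩
    · exact Or.inr (by rw [h0]; rfl)
    · exact Or.inl ⟨ω, by rw [hω]; rfl⟩
  constructor
  -- For each basis vector `b i`, the state `X b` with input `V b` moves at a single frequency `ω`,
  -- where `hG` applies; the energies over the basis sum to those over the columns.
  · rw [← sum_norm_sq_complexify_mulVec b, ← sum_norm_sq_complexify_mulVec b, Finset.mul_sum]
    refine Finset.sum_le_sum fun i _ => ?_
    rw [hmul C D, ← mul_pow]
    refine pow_le_pow_left₀ (norm_nonneg _) ?_ 2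
    rcases hFb i with ⟨ω, hω⟩ | h0
    · refine hG _ _ ω ?_
      rw [← hmul A B]
      exact hω
    -- The state vanishes, which is the case of infinite frequency: only `D` acts.
    · rw [hU] at h0
      rw [h0, mulVec_zero, zero_add]
      have : (complexify D *ᵥ (complexify V *ᵥ (b i).ofLp)) 0 =
          (D 0 0 : ℂ) * (complexify V *ᵥ (b i).ofLp) 0 := by
        simp [mulVec, dotProduct]
      rw [this, norm_mul, Complex.norm_real, Real.norm_eq_abs]
      gcongr
  · intro hV
    have hU0 : U = 0 := by
      refine b.toBasis.ext fun i => ?_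
      rw [b.coe_toBasis, LinearMap.zero_apply]
      apply WithLp.ofLp_injective
      rcases hFb i with ⟨ω, hω⟩ | h0
      · refine hA _ ω ?_
        rw [← hω, hF, hmul A B, hU, hV]
        simp [complexify]
      · exact h0
    have hX0 : complexify X = 0 := by
      have : toEuclideanLin (complexify X) = 0 := hU0
      simpa using this
    ext i j
    have := congrFun (congrFun hX0 i) j
    simpa using this

/-- The real positive semidefinite matrices of trace one. -/
def densityMatrices (k : Type*) [Fintype k] : Set (Matrix k k ℝ) := {Z | Z.PosSemidef ∧ Z.trace = 1}

theorem convex_densityMatrices (k : Type*) [Fintype k] : Convex ℝ (densityMatrices k) := by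
  rintro Z ⟨hZ, hZ1⟩ Y ⟨hY, hY1⟩ a b ha hb hab
  exact ⟨(hZ.smul ha).add (hY.smul hb), by
    rw [trace_add, trace_smul, trace_smul, hZ1, hY1, smul_eq_mul, smul_eq_mul, mul_one, mul_one,
      hab]⟩

/-- Entries are bounded since a Gram matrix has `|Z i j| ≤ (Z i i + Z j j) / 2`. Compactness makes
the later separation strict, which yields `δ > 0`. -/
theorem isCompact_densityMatrices (k : Type*) [Fintype k] [DecidableEq k] :
    IsCompact (densityMatrices k) := by
  have hc : IsCompact (Set.univ.pi fun _ : k => Set.univ.pi fun _ : k => Set.Icc (-1 : ℝ) 1) :=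
    isCompact_univ_pi fun _ => isCompact_univ_pi fun _ => isCompact_Icc
  refine hc.of_isClosed_subset ?_ ?_
  · have : densityMatrices k = {Z : Matrix k k ℝ | Zᵀ = Z} ∩
        (⋂ x : k → ℝ, {Z : Matrix k k ℝ | 0 ≤ x ⬝ᵥ Z *ᵥ x}) ∩ {Z : Matrix k k ℝ | Z.trace = 1} := by
      ext Z
      simp only [densityMatrices, posSemidef_iff_dotProduct_mulVec, Set.mem_ofPred_eq,
        Set.mem_inter_iff, Set.mem_iInter, star_trivial, IsHermitian,
        conjTranspose_eq_transpose_of_trivial]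
    rw [this]
    refine ((isClosed_eq (by fun_prop) continuous_id).inter (isClosed_iInter fun x => ?_)).inter
      (isClosed_eq (by fun_prop) continuous_const)
    exact isClosed_le continuous_const (by fun_prop)
  · rintro Z ⟨hZ, hZ1⟩
    have hdiag : ∀ i, Z i i ≤ 1 := fun i => by
      rw [← hZ1]
      exact Finset.single_le_sum (f := fun i => Z i i) (fun j _ => hZ.diag_nonneg)
        (Finset.mem_univ i)
    obtain ⟨W, rfl⟩ := exists_conjTranspose_mul_self hZ
    intro i _ j _
    have hi := hdiag i
    have hj := hdiag j
    simp only [mul_apply, transpose_apply] at hi hj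
    have h1 : ∀ σ : ℝ, (σ = 1 ∨ σ = -1) → σ * (∑ l, W l i * W l j) ≤ 1 := by
      intro σ hσ
      have : σ * (∑ l, W l i * W l j) ≤ (∑ l, W l i * W l i + ∑ l, W l j * W l j) / 2 := by
        rw [← Finset.sum_add_distrib, Finset.mul_sum, Finset.sum_div]
        refine Finset.sum_le_sum fun l _ => ?_
        rcases hσ with rfl | rfl
        · nlinarith [sq_nonneg (W l i - W l j)]
        · nlinarith [sq_nonneg (W l i + W l j)]
      linarith
    have h2 := h1 1 (Or.inl rfl)
    have h3 := h1 (-1) (Or.inr rfl)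
    change _ ∈ Set.Icc (-1 : ℝ) 1
    simp only [mul_apply, transpose_apply]
    constructor <;> linarith

theorem vecMulVec_mem_densityMatrices {k : Type*} [Fintype k] (w : k → ℝ) (hw : w ⬝ᵥ w = 1) :
    vecMulVec w w ∈ densityMatrices k :=
  ⟨by simpa using posSemidef_vecMulVec_self_star w, by rw [trace_vecMulVec, hw]⟩

/-- Theorem of alternatives behind the Kalman-Yakubovich-Popov lemma. -/
theorem exists_storage_of_no_stationary {n : ℕ} {k : Type*} [Fintype k] [DecidableEq k]
    (N J : Matrix (Fin n) k ℝ) (K e : Matrix (Fin 1) k ℝ) (γ : ℝ)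
    (hne : ∃ w : k → ℝ, w ⬝ᵥ w = 1 ∧ J *ᵥ w = 0)
    (hno : ∀ W : Matrix k k ℝ, (N * W) * (J * W)ᵀ + (J * W) * (N * W)ᵀ = 0 →
      γ ^ 2 * ∑ j, (e * W) 0 j ^ 2 ≤ ∑ j, (K * W) 0 j ^ 2 → W = 0) :
    ∃ P : Matrix (Fin n) (Fin n) ℝ, P.IsSymm ∧ ∃ δ : ℝ, 0 < δ ∧ ∀ w : k → ℝ,
      2 * (J *ᵥ w ⬝ᵥ P *ᵥ (N *ᵥ w)) + (K *ᵥ w) 0 ^ 2 - γ ^ 2 * (e *ᵥ w) 0 ^ 2 + δ * (w ⬝ᵥ w) ≤ 0 := by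
  classical
  have : LocallyConvexSpace ℝ (Matrix (Fin n) (Fin n) ℝ) :=
    inferInstanceAs (LocallyConvexSpace ℝ (Fin n → Fin n → ℝ))
  -- Output energy minus `γ ^ 2` times input energy, paired with the drift of the state Gramian. By
  -- `hno` no density matrix has nonnegative first and zero second component.
  let φ : Matrix k k ℝ → ℝ × Matrix (Fin n) (Fin n) ℝ := fun Z =>
    ((K * Z * Kᵀ) 0 0 - γ ^ 2 * (e * Z * eᵀ) 0 0, N * Z * Jᵀ + J * Z * Nᵀ)
  have hφlin : IsLinearMap ℝ φ := by
    constructor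
    · intro Z Y
      refine Prod.ext ?_ ?_
      · simp only [φ, Matrix.mul_add, Matrix.add_mul, Matrix.add_apply, Prod.fst_add]
        ring
      · simp only [φ, Matrix.mul_add, Matrix.add_mul, Prod.snd_add]
        abel
    · intro c Z
      refine Prod.ext ?_ ?_
      · simp only [φ, Matrix.mul_smul, Matrix.smul_mul, Matrix.smul_apply, Prod.smul_fst, smul_eq_mul]
        ring
      · simp only [φ, Matrix.mul_smul, Matrix.smul_mul, Prod.smul_snd, smul_add]
  have hφcont : Continuous φ := by
    fun_prop
  have hS1 : Convex ℝ (φ '' densityMatrices k) := (convex_densityMatrices k).is_linear_image hφlin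
  have hS2 : IsCompact (φ '' densityMatrices k) := (isCompact_densityMatrices k).image hφcont
  let T : Set (ℝ × Matrix (Fin n) (Fin n) ℝ) := Set.Ici 0 ×ˢ {0}
  have hT1 : Convex ℝ T := (convex_Ici 0).prod (convex_singleton 0)
  have hT2 : IsClosed T := isClosed_Ici.prod isClosed_singleton
  have hdisj : Disjoint (φ '' densityMatrices k) T := by
    rw [Set.disjoint_left]
    rintro _ ⟨Z, ⟨hZ, hZ1⟩, rfl⟩ hZT
    obtain ⟨W, hW⟩ := exists_conjTranspose_mul_self hZ
    obtain ⟨h1, h2⟩ := hZT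
    have h3 : N * Z * Jᵀ + J * Z * Nᵀ = 0 := h2
    have h4 : (0 : ℝ) ≤ (K * Z * Kᵀ) 0 0 - γ ^ 2 * (e * Z * eᵀ) 0 0 := h1
    have hsq : ∀ R : Matrix (Fin 1) k ℝ, (R * Z * Rᵀ) 0 0 = ∑ j, (R * Wᵀ) 0 j ^ 2 := fun R => by
      have : R * Z * Rᵀ = (R * Wᵀ) * (R * Wᵀ)ᵀ := by
        rw [hW, transpose_mul, transpose_transpose]
        simp only [Matrix.mul_assoc]
      rw [this, mul_apply]
      exact Finset.sum_congr rfl fun j _ => by rw [transpose_apply, sq]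
    rw [hsq, hsq] at h4
    have hW0 := hno Wᵀ (by
      rw [← h3, hW]
      simp only [transpose_mul, transpose_transpose, Matrix.mul_assoc]) (by linarith)
    rw [hW, hW0, Matrix.zero_mul, trace_zero] at hZ1
    exact zero_ne_one hZ1
  obtain ⟨f, c, v, hf1, hcv, hf2⟩ := geometric_hahn_banach_compact_closed hS1 hS2 hT1 hT2 hdisj
  have hv : v < 0 := by
    have := hf2 0 ⟨le_refl (0 : ℝ), rfl⟩
    rwa [map_zero] at this
  set a := f (1, 0) with ha
  have hfa : ∀ t X, f (t, X) = t * a + f (0, X) := fun t X => by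
    have : ((t, X) : ℝ × Matrix (Fin n) (Fin n) ℝ) = t • (1, 0) + (0, X) := by
      refine Prod.ext ?_ ?_ <;> simp
    rw [this, map_add, map_smul, smul_eq_mul]
  have ha0 : 0 ≤ a := by
    by_contra hneg
    rw [not_le] at hneg
    have h1 := hf2 (v / a, 0) ⟨(div_nonneg_of_nonpos hv.le hneg.le : (0 : ℝ) ≤ v / a), rfl⟩
    rw [hfa, div_mul_cancel₀ _ hneg.ne, show ((0 : ℝ), (0 : Matrix (Fin n) (Fin n) ℝ)) = 0 from rfl,
      map_zero, add_zero] at h1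
    exact lt_irrefl _ h1
  have hvm : ∀ {p q : ℕ} (M : Matrix (Fin p) k ℝ) (L : Matrix (Fin q) k ℝ) (w : k → ℝ),
      M * vecMulVec w w * Lᵀ = vecMulVec (M *ᵥ w) (L *ᵥ w) := fun M L w => by
    rw [mul_vecMulVec, vecMulVec_mul, vecMul_transpose]
  have hφw : ∀ w : k → ℝ, φ (vecMulVec w w) = ((K *ᵥ w) 0 ^ 2 - γ ^ 2 * (e *ᵥ w) 0 ^ 2,
      vecMulVec (N *ᵥ w) (J *ᵥ w) + vecMulVec (J *ᵥ w) (N *ᵥ w)) := fun w => by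
    simp only [φ, hvm, vecMulVec_apply, ← sq]
  -- `G` represents the functional on drifts; as these are symmetric, only `G + Gᵀ` matters.
  let G : Matrix (Fin n) (Fin n) ℝ := fun i j => f (0, single i j 1)
  have hG : ∀ X : Matrix (Fin n) (Fin n) ℝ, f (0, X) = ∑ i, ∑ j, X i j * G i j := fun X => by
    let g : Matrix (Fin n) (Fin n) ℝ →ₗ[ℝ] ℝ := f.toLinearMap ∘ₗ LinearMap.inr ℝ ℝ _
    change g X = ∑ i, ∑ j, X i j * g (single i j 1)
    conv_lhs => rw [matrix_eq_sum_single X]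
    simp only [map_sum]
    refine Finset.sum_congr rfl fun i _ => Finset.sum_congr rfl fun j _ => ?_
    rw [← smul_eq_mul, ← map_smul, smul_single, smul_eq_mul, mul_one]
  have hGw : ∀ y x : Fin n → ℝ, f (0, vecMulVec y x + vecMulVec x y) = x ⬝ᵥ (G + Gᵀ) *ᵥ y := by
    intro y x
    rw [hG]
    simp only [Matrix.add_apply, vecMulVec_apply, dotProduct, mulVec, transpose_apply, Finset.mul_sum,
      add_mul, mul_add, Finset.sum_add_distrib]
    rw [add_comm]
    congr 1
    · exact Finset.sum_congr rfl fun i _ => Finset.sum_congr rfl fun j _ => by ring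
    · rw [Finset.sum_comm]
      exact Finset.sum_congr rfl fun i _ => Finset.sum_congr rfl fun j _ => by ring
  have hunit : ∀ w : k → ℝ, w ⬝ᵥ w = 1 →
      ((K *ᵥ w) 0 ^ 2 - γ ^ 2 * (e *ᵥ w) 0 ^ 2) * a + J *ᵥ w ⬝ᵥ (G + Gᵀ) *ᵥ (N *ᵥ w) < c := by
    intro w hw
    have := hf1 _ ⟨_, vecMulVec_mem_densityMatrices w hw, rfl⟩
    rwa [hφw, hfa, hGw] at this
  -- Here `hne` is the constraint qualification: for `a = 0` a unit vector with `J w = 0` would give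
  -- `0 < c`, against `c < v < 0`.
  have ha1 : 0 < a := by
    refine lt_of_le_of_ne ha0 fun h0 => ?_
    obtain ⟨w, hw1, hw2⟩ := hne
    have := hunit w hw1
    rw [← h0, hw2, zero_dotProduct] at this
    linarith
  -- The separating functional, normalized to weight 1 on the energy, is the storage matrix; the gap
  -- `-c` becomes the strictness `δ`.
  refine ⟨(1 / (2 * a)) • (G + Gᵀ), ?_, -c / a, div_pos (by linarith) ha1, fun w => ?_⟩
  · rw [IsSymm, transpose_smul, transpose_add, transpose_transpose, add_comm]
  · rcases eq_or_ne w 0 with rfl | hw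
    · simp
    have hpos : 0 < w ⬝ᵥ w := by
      refine lt_of_le_of_ne (Finset.sum_nonneg fun i _ => mul_self_nonneg _) fun h => ?_
      exact hw (dotProduct_self_eq_zero.1 h.symm)
    set s := Real.sqrt (w ⬝ᵥ w) with hs
    have hs0 : 0 < s := Real.sqrt_pos.2 hpos
    have hss : s ^ 2 = w ⬝ᵥ w := Real.sq_sqrt hpos.le
    have h1 := hunit (s⁻¹ • w) (by
      rw [smul_dotProduct, dotProduct_smul, ← hss, smul_eq_mul, smul_eq_mul]
      field_simp)
    simp only [mulVec_smul, smul_dotProduct, dotProduct_smul, Pi.smul_apply, smul_eq_mul] at h1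
    rw [smul_mulVec, dotProduct_smul, smul_eq_mul, ← hss]
    set q := J *ᵥ w ⬝ᵥ (G + Gᵀ) *ᵥ (N *ᵥ w)
    set α := (K *ᵥ w) 0
    set β := (e *ᵥ w) 0
    have h2 : ((α ^ 2 - γ ^ 2 * β ^ 2) * a + q) < c * s ^ 2 := by
      have h3 : ((s⁻¹ * α) ^ 2 - γ ^ 2 * (s⁻¹ * β) ^ 2) * a + s⁻¹ * (s⁻¹ * q) =
          ((α ^ 2 - γ ^ 2 * β ^ 2) * a + q) / s ^ 2 := by
        field_simp
      rw [h3, div_lt_iff₀ (by positivity)] at h1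
      exact h1
    have h4 : 2 * (1 / (2 * a) * q) + α ^ 2 - γ ^ 2 * β ^ 2 + -c / a * s ^ 2 =
        (((α ^ 2 - γ ^ 2 * β ^ 2) * a + q) - c * s ^ 2) / a := by
      field_simp
      ring
    rw [h4]
    exact div_nonpos_of_nonpos_of_nonneg (by linarith) ha1.le

/-- The strict Kalman-Yakubovich-Popov lemma, without controllability assumption. -/
theorem exists_storage_of_frequency_inequality {n : ℕ}
    (A : Matrix (Fin n) (Fin n) ℝ) (B : Matrix (Fin n) (Fin 1) ℝ) (C : Matrix (Fin 1) (Fin n) ℝ)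
    (D : Matrix (Fin 1) (Fin 1) ℝ) {γ₀ γ : ℝ} (hγ₀ : 0 ≤ γ₀) (hγ : γ₀ < γ)
    (hA : ∀ (x : Fin n → ℂ) (ω : ℝ), complexify A *ᵥ x = (ω * Complex.I) • x → x = 0)
    (hG : ∀ (x : Fin n → ℂ) (v : Fin 1 → ℂ) (ω : ℝ),
      complexify A *ᵥ x + complexify B *ᵥ v = (ω * Complex.I) • x →
      ‖(complexify C *ᵥ x + complexify D *ᵥ v) 0‖ ≤ γ₀ * ‖v 0‖)
    (hD : |D 0 0| ≤ γ₀) :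
    ∃ P : Matrix (Fin n) (Fin n) ℝ, P.IsSymm ∧ ∃ δ : ℝ, 0 < δ ∧
      ∀ (x : Fin n → ℝ) (u : Fin 1 → ℝ), 2 * (x ⬝ᵥ P *ᵥ (A *ᵥ x + B *ᵥ u)) + δ * (x ⬝ᵥ x) +
        (C *ᵥ x + D *ᵥ u) ⬝ᵥ (C *ᵥ x + D *ᵥ u) - γ ^ 2 * (u ⬝ᵥ u) ≤ 0 := by
  have hcols : ∀ {p : ℕ} (M : Matrix (Fin p) (Fin n) ℝ) (L : Matrix (Fin p) (Fin 1) ℝ)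
      (W : Matrix (Fin n ⊕ Fin 1) (Fin n ⊕ Fin 1) ℝ),
      fromCols M L * W = M * W.toRows₁ + L * W.toRows₂ := fun M L W => by
    conv_lhs => rw [← fromRows_toRows W]
    rw [fromCols_mul_fromRows]
  obtain ⟨P, hP, δ, hδ, h⟩ := exists_storage_of_no_stationary (fromCols A B)
    (fromCols 1 0) (fromCols C D) (fromCols 0 1) γ
    ⟨Sum.elim 0 1, by simp [sumElim_dotProduct_sumElim], by
      rw [fromCols_mulVec]; simp⟩ (by
    intro W h1 h2
    simp only [hcols, Matrix.one_mul, Matrix.zero_mul, add_zero, zero_add] at h1 h2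
    obtain ⟨h3, h4⟩ := sum_sq_output_le A B C D hA hG hD W.toRows₁ W.toRows₂ h1
    -- The output energy is at least `γ ^ 2` and at most `γ₀ ^ 2` times the input energy, so the
    -- input is zero, and then by `h4` so is the state.
    have h5 : W.toRows₂ = 0 := by
      have hsum : ∑ j, W.toRows₂ 0 j ^ 2 = 0 := by
        refine le_antisymm ?_ (Finset.sum_nonneg fun _ _ => sq_nonneg _)
        have : 0 < γ ^ 2 - γ₀ ^ 2 := by nlinarith
        nlinarith
      ext i j
      have := (Finset.sum_eq_zero_iff_of_nonneg fun _ _ => sq_nonneg _).1 hsum j (Finset.mem_univ j)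
      rw [Subsingleton.elim i 0]
      simpa using this
    rw [← fromRows_toRows W, h4 h5, h5, fromRows_zero])
  refine ⟨P, hP, δ, hδ, fun x u => ?_⟩
  have h1 := h (Sum.elim x u)
  simp only [fromCols_mulVec, Sum.elim_comp_inl, Sum.elim_comp_inr, one_mulVec, zero_mulVec,
    add_zero, zero_add, sumElim_dotProduct_sumElim] at h1
  have h2 : ∀ w : Fin 1 → ℝ, w ⬝ᵥ w = w 0 ^ 2 := fun w => by simp [dotProduct, sq]
  have h3 : 0 ≤ δ * (u ⬝ᵥ u) := by rw [h2]; positivity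
  rw [h2 (C *ᵥ x + D *ᵥ u), h2 u] at *
  linarith

end KYP

/-! ### Gain at one rate, and eigenvalue counts. -/

section Gain

open Filter Topology

theorem mem_complexEigenvalues_iff {n : ℕ} (M : Matrix (Fin n) (Fin n) ℝ) (z : ℂ) :
    z ∈ complexEigenvalues M ↔ ∃ x : Fin n → ℂ, x ≠ 0 ∧ complexify M *ᵥ x = z • x := by
  rw [complexEigenvalues, Polynomial.mem_roots (charpoly_monic _).ne_zero, ← charpoly_toLin',
    ← Module.End.hasEigenvalue_iff_isRoot_charpoly]
  constructor
  · intro h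
    obtain ⟨x, hx, hx0⟩ := h.exists_hasEigenvector
    exact ⟨x, hx0, Module.End.mem_eigenspace_iff.1 hx⟩
  · rintro ⟨x, hx0, hx⟩
    exact Module.End.hasEigenvalue_of_hasEigenvector ⟨Module.End.mem_eigenspace_iff.2 hx, hx0⟩

theorem card_complexEigenvalues {n : ℕ} (M : Matrix (Fin n) (Fin n) ℝ) :
    (complexEigenvalues M).card = n := by
  rw [complexEigenvalues, IsAlgClosed.card_roots_eq_natDegree, charpoly_natDegree_eq_dim,
    Fintype.card_fin]

theorem isUnit_det_of_notMem_complexEigenvalues {n : ℕ} {M : Matrix (Fin n) (Fin n) ℝ} {z : ℂ}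
    (hz : z ∉ complexEigenvalues M) :
    IsUnit (z • (1 : Matrix (Fin n) (Fin n) ℂ) - complexify M).det := by
  rw [isUnit_iff_ne_zero]
  intro h
  refine hz ?_
  rw [complexEigenvalues, Polynomial.mem_roots (charpoly_monic _).ne_zero, Polynomial.IsRoot.def,
    eval_charpoly, ← h, scalar_apply, smul_one_eq_diagonal]

namespace LTISystem

variable {n : ℕ} (S : LTISystem n)

theorem output_eq_transfer_mul {z : ℂ} (hz : z ∉ complexEigenvalues S.A) {x : Fin n → ℂ}
    {v : Fin 1 → ℂ} (h : complexify S.A *ᵥ x + complexify S.B *ᵥ v = z • x) :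
    (complexify S.C *ᵥ x + complexify S.D *ᵥ v) 0 = S.transfer z * v 0 := by
  set R := z • (1 : Matrix (Fin n) (Fin n) ℂ) - complexify S.A with hR
  have h1 : R *ᵥ x = complexify S.B *ᵥ v := by
    rw [hR, sub_mulVec, smul_mulVec, one_mulVec, ← h, add_sub_cancel_left]
  have h2 : x = R⁻¹ *ᵥ (complexify S.B *ᵥ v) := by
    rw [← h1, mulVec_mulVec, nonsing_inv_mul _ (isUnit_det_of_notMem_complexEigenvalues hz),
      one_mulVec]
  rw [h2, mulVec_mulVec, mulVec_mulVec, ← add_mulVec, mulVec, dotProduct, Fin.sum_univ_one]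
  rfl

theorem exists_state_of_notMem {z : ℂ} (hz : z ∉ complexEigenvalues S.A) (v : Fin 1 → ℂ) :
    ∃ x : Fin n → ℂ, complexify S.A *ᵥ x + complexify S.B *ᵥ v = z • x := by
  refine ⟨(z • (1 : Matrix (Fin n) (Fin n) ℂ) - complexify S.A)⁻¹ *ᵥ (complexify S.B *ᵥ v), ?_⟩
  have h : (z • (1 : Matrix (Fin n) (Fin n) ℂ) - complexify S.A) *ᵥ
      ((z • (1 : Matrix (Fin n) (Fin n) ℂ) - complexify S.A)⁻¹ *ᵥ (complexify S.B *ᵥ v)) =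
      complexify S.B *ᵥ v := by
    rw [mulVec_mulVec, mul_nonsing_inv _ (isUnit_det_of_notMem_complexEigenvalues hz), one_mulVec]
  rw [sub_mulVec, smul_mulVec, one_mulVec] at h
  exact add_eq_of_eq_sub' h.symm

/-- The linear matrix inequality bounds the transfer function on a vertical line. -/
theorem norm_transfer_le {r γ ε : ℝ} (hγ : 0 ≤ γ) (hε : 0 ≤ ε) {P : Matrix (Fin n) (Fin n) ℝ}
    (hP : P.IsSymm) (h : (-(S.lmiMatrix r γ ε P)).PosSemidef) {z : ℂ} (hzr : z.re = -r)
    (hz : z ∉ complexEigenvalues S.A) : ‖S.transfer z‖ ≤ γ := by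
  obtain ⟨x, hx⟩ := S.exists_state_of_notMem hz 1
  have h1 := S.complex_form_nonpos hP h x 1
  rw [S.output_eq_transfer_mul hz hx, hx, ← add_smul, mulVec_smul, dotProduct_smul,
    smul_eq_mul] at h1
  have him : (star x ⬝ᵥ complexify P *ᵥ x).im = 0 := by
    have : star (star x ⬝ᵥ complexify P *ᵥ x) = star x ⬝ᵥ complexify P *ᵥ x := by
      rw [← star_dotProduct_star, star_star, star_mulVec, (isHermitian_complexify hP).eq,
        dotProduct_mulVec]
    exact Complex.conj_eq_iff_im.1 this
  -- `x* P x` is real and `Re z + r = 0`, so the storage terms drop out.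
  rw [Complex.mul_re, him, Complex.add_re, Complex.ofReal_re, hzr, re_dotProduct_self] at h1
  have h2 : 0 ≤ ε * ∑ i, ‖x i‖ ^ 2 := by positivity
  simp only [Pi.one_apply, mul_one, norm_one, one_pow] at h1
  refine le_of_sq_le_sq ?_ hγ
  linarith

/-- With zero input the matrix inequality becomes the Lyapunov inequality of the inertia theorem. -/
theorem countP_eq_of_lmiSolvable {p : ℕ} {r : ℝ} {γ : ℝ≥0} (h : S.LMISolvable p r γ)
    (hA : ∀ z ∈ complexEigenvalues S.A, z.re ≠ -r) :
    (complexEigenvalues S.A).countP (fun z => -r < z.re) = p := by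
  obtain ⟨ε, hε, P, hP, hin, hlmi⟩ := h
  rw [inertia, Prod.mk.injEq, Prod.mk.injEq] at hin
  rw [← countP_neg_eq_of_lyapunov hP hin.2.1 hA, hin.1]
  intro x
  have h1 := S.complex_form_nonpos hP hlmi x 0
  rw [re_dotProduct_self] at h1
  simp only [mulVec_zero, add_zero, Pi.zero_apply, norm_zero] at h1
  have h2 : 0 ≤ ε * ∑ i, ‖x i‖ ^ 2 := by positivity
  nlinarith [sq_nonneg ‖(complexify S.C *ᵥ x) 0‖]

/-- The resolvent vanishes at infinity. Hence a bound on a vertical line also bounds `D`, as the KYP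
lemma requires. -/
theorem tendsto_transfer_cobounded :
    Tendsto S.transfer (Bornology.cobounded ℂ) (𝓝 ((S.D 0 0 : ℝ) : ℂ)) := by
  let _ := Matrix.linftyOpNormedRing (n := Fin n) (α := ℂ)
  let _ := Matrix.linftyOpNormedAlgebra (n := Fin n) (R := ℂ) (α := ℂ)
  have : CompleteSpace (Matrix (Fin n) (Fin n) ℂ) := FiniteDimensional.complete ℂ _
  have h := spectrum.resolvent_tendsto_cobounded (𝕜 := ℂ) (complexify S.A)
  have hc : Continuous fun M : Matrix (Fin n) (Fin n) ℂ =>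
      (complexify S.C * M * complexify S.B + complexify S.D) 0 0 := by fun_prop
  have h2 := (hc.tendsto 0).comp h
  have h3 : (complexify S.C * (0 : Matrix (Fin n) (Fin n) ℂ) * complexify S.B +
      complexify S.D) 0 0 = ((S.D 0 0 : ℝ) : ℂ) := by
    simp
  rw [h3] at h2
  refine h2.congr fun z => ?_
  simp only [Function.comp, resolvent, transfer, nonsing_inv_eq_ringInverse,
    Algebra.algebraMap_eq_smul_one]

/-- A bound of the transfer function on a vertical line that contains no eigenvalue makes the linear
matrix inequality solvable, by a matrix whose inertia is determined by the eigenvalues. -/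
theorem lmiSolvable_of_bound {r : ℝ} {γ₀ γ : ℝ≥0} (hγ : γ₀ < γ)
    (hA : ∀ z ∈ complexEigenvalues S.A, z.re ≠ -r)
    (hG : ∀ z : ℂ, z.re = -r → ‖S.transfer z‖ ≤ γ₀) :
    S.LMISolvable ((complexEigenvalues S.A).countP fun z => -r < z.re) r γ := by
  have hline : ∀ ω : ℝ, ((ω : ℂ) * Complex.I - r).re = -r := fun ω => by simp
  have hD : |S.D 0 0| ≤ γ₀ := by
    have hz : Tendsto (fun ω : ℝ => (ω : ℂ) * Complex.I - r) atTop (Bornology.cobounded ℂ) := by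
      rw [← tendsto_norm_atTop_iff_cobounded]
      refine tendsto_atTop_mono (fun ω => ?_) tendsto_id
      have := Complex.abs_im_le_norm ((ω : ℂ) * Complex.I - r)
      have h2 := le_abs_self ω
      simp only [Complex.sub_im, Complex.mul_im, Complex.ofReal_re, Complex.I_im, mul_one,
        Complex.ofReal_im, Complex.I_re, mul_zero, add_zero, sub_zero] at this
      exact h2.trans this
    have h1 := (S.tendsto_transfer_cobounded.comp hz).norm
    rw [Complex.norm_real, Real.norm_eq_abs] at h1
    exact le_of_tendsto' h1 fun ω => hG _ (hline ω)
  have hshift : ∀ x : Fin n → ℂ, complexify (S.A + r • (1 : Matrix (Fin n) (Fin n) ℝ)) *ᵥ x =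
      complexify S.A *ᵥ x + (r : ℂ) • x := fun x => by
    have : complexify (S.A + r • (1 : Matrix (Fin n) (Fin n) ℝ)) =
        complexify S.A + (r : ℂ) • (1 : Matrix (Fin n) (Fin n) ℂ) := by
      ext i j
      by_cases hij : i = j <;> simp [hij]
    rw [this, add_mulVec, smul_mulVec, one_mulVec]
  -- Replacing `A` by `A + r` moves the line `Re s = -r` to the imaginary axis.
  obtain ⟨P, hP, δ, hδ, h⟩ := exists_storage_of_frequency_inequality
    (S.A + r • (1 : Matrix (Fin n) (Fin n) ℝ)) S.B S.C S.D (γ₀ := γ₀) (γ := γ) γ₀.2 hγ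
    (fun x ω hx => by
      by_contra hx0
      refine hA _ ((mem_complexEigenvalues_iff S.A _).2 ⟨x, hx0, ?_⟩) (hline ω)
      rw [hshift] at hx
      rw [sub_smul, ← hx, add_sub_cancel_right])
    (fun x v ω hx => by
      rw [hshift] at hx
      rw [S.output_eq_transfer_mul (z := ω * Complex.I - r) (fun hz => hA _ hz (hline ω)) (by
        rw [sub_smul, ← hx]; abel), norm_mul]
      exact mul_le_mul_of_nonneg_right (hG _ (hline ω)) (norm_nonneg _)) hD
  have hlmi : (-(S.lmiMatrix r γ δ P)).PosSemidef := by
    rw [S.neg_lmiMatrix_posSemidef_iff r γ δ hP]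
    intro x u
    have h1 := h x u
    rw [add_mulVec, smul_mulVec, one_mulVec, mulVec_add, mulVec_add, mulVec_smul, dotProduct_add,
      dotProduct_add, dotProduct_smul, smul_eq_mul] at h1
    rw [mulVec_add, dotProduct_add]
    linarith
  have hform := fun x => S.complex_form_nonpos hP hlmi x 0
  simp only [mulVec_zero, add_zero, Pi.zero_apply, norm_zero, re_dotProduct_self] at hform
  -- Strictness makes `P` nonsingular: on a kernel vector the inequality leaves `δ ‖x‖² ≤ 0`.
  have h0 : (complexEigenvalues P).countP (fun z => z.re = 0) = 0 := by
    rw [Multiset.countP_eq_zero]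
    intro z hz hre
    have hz0 : z = 0 := by
      have hz' := hz
      rw [complexEigenvalues_of_isSymm hP] at hz'
      obtain ⟨i, -, rfl⟩ := Multiset.mem_map.1 hz'
      rw [Complex.ofReal_re] at hre
      rw [hre, Complex.ofReal_zero]
    obtain ⟨x, hx0, hx⟩ := (mem_complexEigenvalues_iff P z).1 hz
    rw [hz0, zero_smul] at hx
    have h1 := hform x
    rw [dotProduct_mulVec, ← (isHermitian_complexify hP).eq, ← star_mulVec, hx, star_zero,
      zero_dotProduct] at h1
    have h2 : ∑ i, ‖x i‖ ^ 2 = 0 := by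
      refine le_antisymm ?_ (by positivity)
      have : δ * ∑ i, ‖x i‖ ^ 2 ≤ 0 := by
        have := sq_nonneg ‖(complexify S.C *ᵥ x) 0‖
        simp only [Complex.zero_re] at h1
        linarith
      nlinarith
    refine hx0 (funext fun i => ?_)
    have := (Finset.sum_eq_zero_iff_of_nonneg fun _ _ => sq_nonneg _).1 h2 i (Finset.mem_univ i)
    simpa using this
  have hneg := countP_neg_eq_of_lyapunov hP h0 hA fun x => by
    have h1 := hform x
    have h2 : 0 ≤ δ * ∑ i, ‖x i‖ ^ 2 := by positivity
    nlinarith [sq_nonneg ‖(complexify S.C *ᵥ x) 0‖]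
  refine ⟨δ, hδ.le, P, hP, ?_, hlmi⟩
  rw [inertia, hneg, h0, ← hneg]
  congr 2
  have h1 := (complexEigenvalues P).card_eq_countP_add_countP (fun z => z.re < 0)
  rw [card_complexEigenvalues] at h1
  have h2 : (complexEigenvalues P).countP (fun z => ¬ z.re < 0) =
      (complexEigenvalues P).countP (fun z => 0 < z.re) := by
    refine Multiset.countP_congr rfl fun z hz => ?_
    have := Multiset.countP_eq_zero.1 h0 z hz
    simp only [not_lt, eq_iff_iff]
    exact ⟨fun h => lt_of_le_of_ne h (Ne.symm this), le_of_lt⟩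
  omega

theorem gainAt_eq_iInf_lmiSolvable (p : ℕ) (r : ℝ) :
    S.gainAt p r = ⨅ (γ : ℝ≥0) (_ : S.LMISolvable p r γ), (γ : ℝ≥0∞) := by
  simp only [gainAt, hasGain_iff_lmiSolvable]

/-- The KYP lemma is strict, so only the `γ > M` are shown to be admissible; this suffices for the
infimum. -/
theorem gainAt_le_of_bound {p : ℕ} {r : ℝ} {M : ℝ≥0∞}
    (hA : ∀ z ∈ complexEigenvalues S.A, z.re ≠ -r)
    (hp : (complexEigenvalues S.A).countP (fun z => -r < z.re) = p)
    (hG : ∀ z : ℂ, z.re = -r → ‖S.transfer z‖ₑ ≤ M) : S.gainAt p r ≤ M := by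
  rw [gainAt_eq_iInf_lmiSolvable]
  refine le_of_forall_gt_imp_ge_of_dense fun a ha => ?_
  obtain ⟨γ, hγ1, hγ2⟩ := ENNReal.lt_iff_exists_nnreal_btwn.1 ha
  have hMtop : M ≠ ⊤ := (hγ1.trans_le le_top).ne
  lift M to ℝ≥0 using hMtop
  refine le_trans (iInf₂_le γ ?_) hγ2.le
  rw [← hp]
  refine S.lmiSolvable_of_bound (ENNReal.coe_lt_coe.1 hγ1) hA fun z hz => ?_
  have h1 := hG z hz
  rw [enorm_eq_nnnorm, ENNReal.coe_le_coe] at h1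
  exact_mod_cast h1

theorem enorm_transfer_le_gainAt (p : ℕ) {z : ℂ} (hz : z ∉ complexEigenvalues S.A) :
    ‖S.transfer z‖ₑ ≤ S.gainAt p (-z.re) := by
  rw [gainAt_eq_iInf_lmiSolvable]
  refine le_iInf₂ fun γ hγ => ?_
  obtain ⟨ε, hε, P, hP, -, hlmi⟩ := hγ
  have := S.norm_transfer_le γ.2 hε hP hlmi (z := z) (by simp) hz
  rw [enorm_eq_nnnorm, ENNReal.coe_le_coe]
  exact_mod_cast this

theorem exists_lmiSolvable_of_gain_lt_top {p : ℕ} {lo hi : EReal} (h : S.gain p lo hi < ⊤) {r : ℝ}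
    (h1 : lo < (r : EReal)) (h2 : (r : EReal) < hi) : ∃ γ : ℝ≥0, S.LMISolvable p r γ := by
  by_contra hno
  have : S.gainAt p r = ⊤ := by
    rw [gainAt_eq_iInf_lmiSolvable]
    simp only [iInf_eq_top]
    exact fun γ hγ => absurd ⟨γ, hγ⟩ hno
  have h3 : S.gainAt p r ≤ S.gain p lo hi :=
    le_iSup₂ (f := fun (r : ℝ) (_ : lo < (r : EReal) ∧ (r : EReal) < hi) => S.gainAt p r) r ⟨h1, h2⟩
  rw [this] at h3
  exact absurd h (not_lt.2 h3)

/-- A finite gain excludes eigenvalues in the strip. -/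
theorem notMem_strip_of_gain_lt_top {p : ℕ} {lo hi : EReal} (h : S.gain p lo hi < ⊤) {z : ℂ}
    (hz : z ∈ complexEigenvalues S.A) : z ∉ strip lo hi := by
  rintro ⟨hlo, hhi⟩
  obtain ⟨a, ha1, ha2⟩ := EReal.lt_iff_exists_real_btwn.1 hlo
  obtain ⟨b, hb1, hb2⟩ := EReal.lt_iff_exists_real_btwn.1 hhi
  rw [EReal.coe_lt_coe_iff] at ha2 hb1
  have hfin : ((fun w : ℂ => -w.re) '' {w | w ∈ complexEigenvalues S.A}).Finite := by
    refine Set.Finite.image _ ?_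
    classical
    exact (complexEigenvalues S.A).toFinset.finite_toSet.subset fun w hw => by simpa using hw
  -- Rates `r₁ < -Re z < r₂` in `Λ` whose lines avoid all eigenvalues. Both counts equal `p`, yet
  -- everything counted at `r₁` is counted at `r₂`, and `z` only at `r₂`.
  obtain ⟨r₁, hr₁, hr₁'⟩ := (Set.Ioo_infinite ha2).exists_notMem_finite hfin
  obtain ⟨r₂, hr₂, hr₂'⟩ := (Set.Ioo_infinite hb1).exists_notMem_finite hfin
  have hcount : ∀ r : ℝ, lo < (r : EReal) → (r : EReal) < hi →
      r ∉ (fun w : ℂ => -w.re) '' {w | w ∈ complexEigenvalues S.A} →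
      (complexEigenvalues S.A).countP (fun w => -r < w.re) = p := fun r h1 h2 h3 => by
    obtain ⟨γ, hγ⟩ := S.exists_lmiSolvable_of_gain_lt_top h h1 h2
    exact S.countP_eq_of_lmiSolvable hγ fun w hw hre => h3 ⟨w, hw, by simp [hre]⟩
  have e₁ := hcount r₁ (ha1.trans (EReal.coe_lt_coe_iff.2 hr₁.1))
    ((EReal.coe_lt_coe_iff.2 hr₁.2).trans hhi) hr₁'
  have e₂ := hcount r₂ (hlo.trans (EReal.coe_lt_coe_iff.2 hr₂.1))
    ((EReal.coe_lt_coe_iff.2 hr₂.2).trans hb2) hr₂'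
  obtain ⟨t, ht⟩ := Multiset.exists_cons_of_mem hz
  have hr₁2 := hr₁.2
  have hr₂1 := hr₂.1
  rw [ht, Multiset.countP_cons_of_neg _ (by linarith)] at e₁
  rw [ht, Multiset.countP_cons_of_pos _ (by linarith)] at e₂
  have : t.countP (fun w => -r₁ < w.re) ≤ t.countP (fun w => -r₂ < w.re) := by
    rw [Multiset.countP_eq_card_filter, Multiset.countP_eq_card_filter]
    exact Multiset.card_le_card (Multiset.monotone_filter_right t fun w hw => by linarith)
  omega

end LTISystem

end Gain

/-! ### The transfer function as a rational function. -/

section Poles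

open Filter Topology Polynomial

theorem isOpen_strip (lo hi : EReal) : IsOpen (strip lo hi) := by
  have hc : Continuous fun s : ℂ => ((-s.re : ℝ) : EReal) :=
    continuous_coe_real_ereal.comp (by fun_prop)
  exact (isOpen_lt continuous_const hc).inter (isOpen_lt hc continuous_const)

/-- A continuous function on an open set is bounded by its essential supremum. -/
theorem enorm_le_essSup_of_isOpen {f : ℂ → ℂ} {U : Set ℂ} (hU : IsOpen U)
    (hf : ∀ s ∈ U, ContinuousAt f s) {s : ℂ} (hs : s ∈ U) :
    ‖f s‖ₑ ≤ essSup (fun s => ‖f s‖ₑ) (volume.restrict U) := by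
  by_contra hlt
  rw [not_le] at hlt
  have h1 : ∀ᶠ w in 𝓝 s, essSup (fun s => ‖f s‖ₑ) (volume.restrict U) < ‖f w‖ₑ :=
    (hf s hs).enorm.eventually_const_lt hlt
  -- The set where the essential supremum is exceeded contains a neighbourhood of `s` within `U`, so
  -- it is not null.
  have h2 : {w | essSup (fun s => ‖f s‖ₑ) (volume.restrict U) < ‖f w‖ₑ} ∩ U ∈ 𝓝 s :=
    inter_mem h1 (hU.mem_nhds hs)
  have h3 := Measure.measure_pos_of_mem_nhds volume h2
  have h4 : volume.restrict U {w | ¬ ‖f w‖ₑ ≤ essSup (fun s => ‖f s‖ₑ) (volume.restrict U)} = 0 :=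
    ENNReal.ae_le_essSup (μ := volume.restrict U) fun s => ‖f s‖ₑ
  simp only [not_le] at h4
  rw [Measure.restrict_apply' hU.measurableSet] at h4
  exact h3.ne' h4

namespace LTISystem

variable {n : ℕ} (S : LTISystem n)

/-- The numerator of the transfer function over the characteristic polynomial. -/
def numerator : ℂ[X] :=
  ((complexify S.C).map Polynomial.C * (charmatrix (complexify S.A)).adjugate *
    (complexify S.B).map Polynomial.C +
      (complexify S.A).charpoly • (complexify S.D).map Polynomial.C) 0 0

theorem transfer_mul_charpoly {z : ℂ} (hz : z ∉ complexEigenvalues S.A) :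
    S.transfer z * (complexify S.A).charpoly.eval z = S.numerator.eval z := by
  set R := z • (1 : Matrix (Fin n) (Fin n) ℂ) - complexify S.A with hR
  have hdet : (complexify S.A).charpoly.eval z = R.det := by
    rw [eval_charpoly, scalar_apply, hR, smul_one_eq_diagonal]
  have hu : IsUnit R.det := isUnit_det_of_notMem_complexEigenvalues hz
  have hadj : (charmatrix (complexify S.A)).adjugate.map (Polynomial.evalRingHom z) =
      R.adjugate := by
    have h1 := RingHom.map_adjugate (Polynomial.evalRingHom z) (charmatrix (complexify S.A))
    rw [RingHom.mapMatrix_apply, RingHom.mapMatrix_apply] at h1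
    rw [h1]
    congr 1
    ext i j
    by_cases hij : i = j
    · subst hij; simp [hR, charmatrix]
    · simp [hR, charmatrix, hij]
  have hev : ∀ {k l : ℕ} (M : Matrix (Fin k) (Fin l) ℂ),
      (M.map Polynomial.C).map (Polynomial.evalRingHom z) = M := fun M => by
    ext i j
    simp
  have h2 : S.numerator.eval z = (((complexify S.C).map Polynomial.C *
      (charmatrix (complexify S.A)).adjugate * (complexify S.B).map Polynomial.C +
      (complexify S.A).charpoly • (complexify S.D).map Polynomial.C).map
        (Polynomial.evalRingHom z)) 0 0 := rfl
  rw [h2, Matrix.map_add _ (map_add _), Matrix.map_mul, Matrix.map_mul, hadj, hev, hev]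
  have h3 : ((complexify S.A).charpoly • (complexify S.D).map Polynomial.C).map
      (Polynomial.evalRingHom z) = R.det • complexify S.D := by
    ext i j
    simp [← hdet]
  have h4 : R.adjugate = R.det • R⁻¹ := by
    rw [inv_def, smul_smul, Ring.mul_inverse_cancel _ hu, one_smul]
  rw [h3, h4, hdet, Matrix.mul_smul, Matrix.smul_mul, ← smul_add, Matrix.smul_apply, smul_eq_mul,
    mul_comm]
  rfl

theorem eventually_notMem_complexEigenvalues (z : ℂ) :
    ∀ᶠ w in 𝓝[≠] z, w ∉ complexEigenvalues S.A := by
  classical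
  have h := (((complexEigenvalues S.A).toFinset.erase z).finite_toSet.isClosed.isOpen_compl).mem_nhds
    (show z ∈ _ by simp)
  filter_upwards [nhdsWithin_le_nhds h, self_mem_nhdsWithin] with w hw hwz hmem
  exact hw (by simpa [hmem] using hwz)

/-- The neighbourhood is punctured because at an eigenvalue the matrix inverse defaults to zero and
`transfer` takes the value `D`. -/
theorem transfer_eventuallyEq (z : ℂ) : S.transfer =ᶠ[𝓝[≠] z]
    fun w => S.numerator.eval w / (complexify S.A).charpoly.eval w := by
  filter_upwards [S.eventually_notMem_complexEigenvalues z] with w hw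
  rw [← S.transfer_mul_charpoly hw, mul_div_cancel_right₀]
  intro h
  exact hw ((Polynomial.mem_roots (charpoly_monic _).ne_zero).2 h)

theorem analyticAt_transfer {z : ℂ} (hz : z ∉ complexEigenvalues S.A) :
    AnalyticAt ℂ S.transfer z := by
  classical
  have hne : (complexify S.A).charpoly.eval z ≠ 0 := fun h =>
    hz ((Polynomial.mem_roots (charpoly_monic _).ne_zero).2 h)
  have h1 : AnalyticAt ℂ (fun w => S.numerator.eval w / (complexify S.A).charpoly.eval w) z :=
    (AnalyticOnNhd.eval_polynomial S.numerator z trivial).div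
      (AnalyticOnNhd.eval_polynomial (complexify S.A).charpoly z trivial) hne
  refine h1.congr ?_
  have h2 := (complexEigenvalues S.A).toFinset.finite_toSet.isClosed.isOpen_compl.mem_nhds
    (show z ∈ _ by simpa using hz)
  filter_upwards [h2] with w hw
  have hw' : w ∉ complexEigenvalues S.A := by simpa using hw
  rw [← S.transfer_mul_charpoly hw', mul_div_cancel_right₀]
  intro h
  exact hw' ((Polynomial.mem_roots (charpoly_monic _).ne_zero).2 h)

theorem meromorphicAt_transfer (z : ℂ) : MeromorphicAt S.transfer z := by
  have h1 : MeromorphicAt (fun w => S.numerator.eval w / (complexify S.A).charpoly.eval w) z :=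
    (AnalyticOnNhd.eval_polynomial S.numerator z trivial).meromorphicAt.div
      (AnalyticOnNhd.eval_polynomial (complexify S.A).charpoly z trivial).meromorphicAt
  exact h1.congr (S.transfer_eventuallyEq z).symm

/-- Splitting `(w - z) ^ m` off the characteristic polynomial leaves a quotient analytic at `z`.
Equality can fail, as the numerator may vanish there. -/
theorem poleOrder_transfer_le (z : ℂ) :
    poleOrder S.transfer z ≤ (complexify S.A).charpoly.rootMultiplicity z := by
  set χ := (complexify S.A).charpoly with hχ
  have hχ0 : χ ≠ 0 := (charpoly_monic _).ne_zero
  set m := χ.rootMultiplicity z with hm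
  obtain ⟨q, hq, hqz⟩ := Polynomial.exists_eq_pow_rootMultiplicity_mul_and_not_dvd χ hχ0 z
  rw [Polynomial.dvd_iff_isRoot, Polynomial.IsRoot.def] at hqz
  have hg : AnalyticAt ℂ (fun w => S.numerator.eval w / q.eval w) z :=
    (AnalyticOnNhd.eval_polynomial S.numerator z trivial).div
      (AnalyticOnNhd.eval_polynomial q z trivial) hqz
  have hlin : MeromorphicAt (fun w : ℂ => w - z) z := by fun_prop
  have hord : meromorphicOrderAt (fun w : ℂ => w - z) z = ((1 : ℤ) : WithTop ℤ) := by
    rw [meromorphicOrderAt_eq_int_iff hlin]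
    exact ⟨fun _ => 1, analyticAt_const, one_ne_zero, Eventually.of_forall fun w => by simp⟩
  have heq : S.transfer =ᶠ[𝓝[≠] z]
      ((fun w : ℂ => w - z) ^ (-(m : ℤ))) * (fun w => S.numerator.eval w / q.eval w) := by
    refine (S.transfer_eventuallyEq z).trans (Eventually.of_forall fun w => ?_)
    have : χ.eval w = (w - z) ^ m * q.eval w := by
      conv_lhs => rw [hq]
      simp [hm]
    change S.numerator.eval w / χ.eval w =
      (w - z) ^ (-(m : ℤ)) * (S.numerator.eval w / q.eval w)
    rw [this, _root_.zpow_neg, zpow_natCast, div_eq_mul_inv, mul_inv, div_eq_mul_inv]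
    ring
  have h1 : ((-(m : ℤ) : ℤ) : WithTop ℤ) ≤ meromorphicOrderAt S.transfer z := by
    rw [meromorphicOrderAt_congr heq, meromorphicOrderAt_mul (hlin.zpow _) hg.meromorphicAt,
      meromorphicOrderAt_zpow hlin, hord]
    have h2 := hg.meromorphicOrderAt_nonneg
    have h3 : ((-(m : ℤ) : ℤ) : WithTop ℤ) * ((1 : ℤ) : WithTop ℤ) = ((-(m : ℤ) : ℤ) : WithTop ℤ) := by
      simp
    rw [h3]
    exact le_add_of_nonneg_right h2
  rw [poleOrder]
  cases h4 : meromorphicOrderAt S.transfer z with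
  -- If `transfer` vanishes identically near `z`, the order is `⊤` and `untop₀` turns it into 0: no
  -- pole.
  | top => simp
  | coe k =>
    rw [h4, WithTop.coe_le_coe] at h1
    rw [WithTop.untop₀_coe]
    omega

end LTISystem

end Poles

/-! ### Poles relative to the strip, and the second and third claims. -/

section Strip

open Filter Topology Polynomial

namespace LTISystem

variable {n : ℕ} (S : LTISystem n)

theorem support_poleOrder_subset :
    Function.support (poleOrder S.transfer) ⊆ (complexEigenvalues S.A).toFinset := by
  intro z hz
  have h1 : 0 < (complexify S.A).charpoly.rootMultiplicity z :=
    (Nat.pos_of_ne_zero hz).trans_le (S.poleOrder_transfer_le z)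
  rw [Finset.mem_coe, Multiset.mem_toFinset]
  exact (Polynomial.mem_roots (charpoly_monic _).ne_zero).2
    ((Polynomial.rootMultiplicity_pos (charpoly_monic _).ne_zero).1 h1)

/-- If the transfer function has `n` poles then its poles are the eigenvalues, with multiplicity. -/
theorem poleOrder_transfer_eq (h : HasPoleCount S.transfer Set.univ n) (z : ℂ) :
    poleOrder S.transfer z = (complexify S.A).charpoly.rootMultiplicity z := by
  have h1 := h.2
  rw [finsum_mem_univ, finsum_eq_sum_of_support_subset _ S.support_poleOrder_subset] at h1
  have h2 : ∑ μ ∈ (complexEigenvalues S.A).toFinset,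
      (complexify S.A).charpoly.rootMultiplicity μ = n := by
    conv_rhs => rw [← card_complexEigenvalues S.A, ← Multiset.toFinset_sum_count_eq]
    exact Finset.sum_congr rfl fun μ _ => (Polynomial.count_roots _).symm
  by_cases hz : z ∈ (complexEigenvalues S.A).toFinset
  -- Pole orders are termwise at most the multiplicities and both sum to `n`, so they agree
  -- termwise.
  · exact (Finset.sum_eq_sum_iff_of_le fun i _ => S.poleOrder_transfer_le i).1 (h1.trans h2.symm) z hz
  · have h3 : (complexify S.A).charpoly.rootMultiplicity z = 0 := by
      rw [← Polynomial.count_roots, Multiset.count_eq_zero]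
      exact fun hmem => hz (Multiset.mem_toFinset.2 hmem)
    have := S.poleOrder_transfer_le z
    omega

open Classical in
theorem hasPoleCount_iff (h : HasPoleCount S.transfer Set.univ n) (U : Set ℂ) (k : ℕ) :
    HasPoleCount S.transfer U k ↔ (complexEigenvalues S.A).countP (fun z => z ∈ U) = k := by
  have hfin : {s ∈ U | poleOrder S.transfer s ≠ 0}.Finite :=
    (complexEigenvalues S.A).toFinset.finite_toSet.subset fun s hs =>
      S.support_poleOrder_subset hs.2
  have hsum : ∑ᶠ s ∈ U, poleOrder S.transfer s =
      (complexEigenvalues S.A).countP (fun z => z ∈ U) := by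
    rw [complexEigenvalues, ← sum_rootMultiplicity_filter,
      finsum_mem_eq_sum_of_inter_support_eq (t :=
        (complexify S.A).charpoly.roots.toFinset.filter fun z => z ∈ U)]
    · exact Finset.sum_congr rfl fun z _ => S.poleOrder_transfer_eq h z
    · ext z
      constructor
      · rintro ⟨h1, h2⟩
        exact ⟨by
          rw [Finset.coe_filter]
          exact ⟨S.support_poleOrder_subset h2, h1⟩, h2⟩
      · rintro ⟨h1, h2⟩
        exact ⟨(Finset.mem_filter.1 h1).2, h2⟩
  rw [HasPoleCount, hsum]
  exact and_iff_right hfin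

theorem memHInf_and_gain_eq (p : ℕ) (lo hi : EReal) (h : S.gain p lo hi < ⊤) :
    MemHInf lo hi S.transfer ∧ S.gain p lo hi = hInfNorm lo hi S.transfer := by
  have hno : ∀ z ∈ strip lo hi, z ∉ complexEigenvalues S.A := fun z hz hz' =>
    S.notMem_strip_of_gain_lt_top h hz' hz
  have han : AnalyticOnNhd ℂ S.transfer (strip lo hi) := fun z hz =>
    S.analyticAt_transfer (hno z hz)
  have hle : hInfNorm lo hi S.transfer ≤ S.gain p lo hi := by
    refine essSup_le_of_ae_le _ ?_
    refine (ae_restrict_iff' (isOpen_strip lo hi).measurableSet).2 (Eventually.of_forall ?_)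
    intro z hz
    exact (S.enorm_transfer_le_gainAt p (hno z hz)).trans
      (le_iSup₂ (f := fun (r : ℝ) (_ : lo < (r : EReal) ∧ (r : EReal) < hi) => S.gainAt p r) _ hz)
  have hge : S.gain p lo hi ≤ hInfNorm lo hi S.transfer := by
    refine iSup₂_le fun r hr => ?_
    have hline : ∀ z : ℂ, z.re = -r → z ∈ strip lo hi := fun z hz => by
      rw [strip, Set.mem_ofPred_eq, hz, neg_neg]
      exact hr
    have hA : ∀ z ∈ complexEigenvalues S.A, z.re ≠ -r := fun z hz hre => hno z (hline z hre) hz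
    obtain ⟨γ, hγ⟩ := S.exists_lmiSolvable_of_gain_lt_top h hr.1 hr.2
    exact S.gainAt_le_of_bound hA (S.countP_eq_of_lmiSolvable hγ hA) fun z hz =>
      enorm_le_essSup_of_isOpen (isOpen_strip lo hi) (fun s hs => (han s hs).continuousAt)
        (hline z hz)
  exact ⟨⟨han, hle.trans_lt h⟩, le_antisymm hge hle⟩

/-- A function that is bounded on a strip has no pole on the right boundary line of the strip. -/
theorem meromorphicOrderAt_nonneg_of_memHInf {lo hi : EReal} (hΛ : lo < hi) {f : ℂ → ℂ}
    (hf : MemHInf lo hi f) {z : ℂ} (hz : ((-z.re : ℝ) : EReal) = lo) :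
    0 ≤ meromorphicOrderAt f z := by
  by_contra hneg
  rw [not_le] at hneg
  have h1 := tendsto_cobounded_of_meromorphicOrderAt_neg hneg
  -- The boundary point is approached horizontally from inside the strip; at a pole `|f|` would
  -- exceed its essential supremum along this path.
  have hpath : Tendsto (fun t : ℝ => z - (t : ℂ)) (𝓝[>] 0) (𝓝[≠] z) := by
    refine tendsto_nhdsWithin_iff.2 ⟨?_, ?_⟩
    · have : Continuous fun t : ℝ => z - (t : ℂ) := by fun_prop
      have h2 := this.tendsto 0
      rw [Complex.ofReal_zero, sub_zero] at h2
      exact h2.mono_left nhdsWithin_le_nhds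
    · filter_upwards [self_mem_nhdsWithin] with t ht
      have ht0 : t ≠ 0 := (Set.mem_Ioi.1 ht).ne'
      simpa using ht0
  have h3 := tendsto_norm_atTop_iff_cobounded.2 (h1.comp hpath)
  have h4 := h3.eventually_gt_atTop (hInfNorm lo hi f).toReal
  obtain ⟨b, hb1, hb2⟩ := EReal.lt_iff_exists_real_btwn.1 hΛ
  rw [← hz, EReal.coe_lt_coe_iff] at hb1
  have h5 : ∀ᶠ t in 𝓝[>] (0 : ℝ), t < b + z.re :=
    nhdsWithin_le_nhds (gt_mem_nhds (by linarith))
  obtain ⟨t, ht4, ht5, ht0⟩ := (h4.and (h5.and self_mem_nhdsWithin)).exists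
  have ht0' : (0 : ℝ) < t := ht0
  have hmem : z - (t : ℂ) ∈ strip lo hi := by
    rw [strip, Set.mem_ofPred_eq, Complex.sub_re, Complex.ofReal_re, ← hz, EReal.coe_lt_coe_iff]
    refine ⟨by linarith, lt_trans ?_ hb2⟩
    rw [EReal.coe_lt_coe_iff]
    linarith
  have h6 := enorm_le_essSup_of_isOpen (isOpen_strip lo hi)
    (fun s hs => (hf.1 s hs).continuousAt) hmem
  have h7 := ENNReal.toReal_mono hf.2.ne h6
  rw [toReal_enorm] at h7
  exact absurd ht4 (not_lt.2 h7)

theorem notMem_complexEigenvalues_of_meromorphicOrderAt_nonneg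
    (h : HasPoleCount S.transfer Set.univ n) {z : ℂ} (hz : 0 ≤ meromorphicOrderAt S.transfer z) :
    z ∉ complexEigenvalues S.A := by
  intro hmem
  have h1 : 0 < (complexify S.A).charpoly.rootMultiplicity z :=
    (Polynomial.rootMultiplicity_pos (charpoly_monic _).ne_zero).2
      ((Polynomial.mem_roots (charpoly_monic _).ne_zero).1 hmem)
  rw [← S.poleOrder_transfer_eq h, poleOrder] at h1
  cases h2 : meromorphicOrderAt S.transfer z with
  | top => simp [h2] at h1
  | coe k =>
    rw [h2, WithTop.untop₀_coe] at h1
    rw [h2] at hz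
    have : (0 : ℤ) ≤ k := by exact_mod_cast hz
    omega

-- An eigenvalue is a pole here, so none lies in the strip, where `G` is analytic, or on its right
-- boundary line, where boundedness excludes it. Thus those to the right of the line at rate `r` are
-- already to the right of the strip.
open Classical in
theorem countP_rightOfStrip_eq {lo hi : EReal} (hΛ : lo < hi)
    (h : HasPoleCount S.transfer Set.univ n) (hf : MemHInf lo hi S.transfer) {r : ℝ}
    (h1 : lo < (r : EReal)) (h2 : (r : EReal) < hi) :
    (complexEigenvalues S.A).countP (fun z => z ∈ rightOfStrip lo) =
      (complexEigenvalues S.A).countP (fun z => -r < z.re) := by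
  refine Multiset.countP_congr rfl fun z hz => ?_
  rw [rightOfStrip, Set.mem_ofPred_eq, eq_iff_iff]
  have hr : -r < z.re ↔ ((-z.re : ℝ) : EReal) < (r : EReal) := by
    rw [EReal.coe_lt_coe_iff, neg_lt]
  rw [hr]
  refine ⟨fun h3 => h3.trans h1, fun h3 => lt_of_le_of_ne (not_lt.1 fun h4 => ?_) fun h4 => ?_⟩
  · exact S.notMem_complexEigenvalues_of_meromorphicOrderAt_nonneg h
      (hf.1 z ⟨h4, h3.trans h2⟩).meromorphicOrderAt_nonneg hz
  · exact S.notMem_complexEigenvalues_of_meromorphicOrderAt_nonneg h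
      (meromorphicOrderAt_nonneg_of_memHInf hΛ hf h4) hz

theorem gain_lt_top_iff_memHInfP (p : ℕ) {lo hi : EReal} (hΛ : lo < hi)
    (h : HasPoleCount S.transfer Set.univ n) :
    S.gain p lo hi < ⊤ ↔ MemHInfP p lo hi S.transfer := by
  classical
  constructor
  · intro hg
    have hf := (S.memHInf_and_gain_eq p lo hi hg).1
    refine ⟨hf, fun z _ => S.meromorphicAt_transfer z, (S.hasPoleCount_iff h _ _).2 ?_⟩
    obtain ⟨r, hr1, hr2⟩ := EReal.lt_iff_exists_real_btwn.1 hΛ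
    obtain ⟨γ, hγ⟩ := S.exists_lmiSolvable_of_gain_lt_top hg hr1 hr2
    rw [S.countP_rightOfStrip_eq hΛ h hf hr1 hr2]
    refine S.countP_eq_of_lmiSolvable hγ fun z hz hre => S.notMem_strip_of_gain_lt_top hg hz ?_
    rw [strip, Set.mem_ofPred_eq, hre, neg_neg]
    exact ⟨hr1, hr2⟩
  · rintro ⟨hf, -, hp⟩
    rw [S.hasPoleCount_iff h] at hp
    refine lt_of_le_of_lt (iSup₂_le fun r hr => ?_) hf.2
    have hline : ∀ z : ℂ, z.re = -r → z ∈ strip lo hi := fun z hz => by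
      rw [strip, Set.mem_ofPred_eq, hz, neg_neg]
      exact hr
    refine S.gainAt_le_of_bound (fun z hz hre => ?_) ?_ fun z hz =>
      enorm_le_essSup_of_isOpen (isOpen_strip lo hi) (fun s hs => (hf.1 s hs).continuousAt)
        (hline z hz)
    · exact S.notMem_complexEigenvalues_of_meromorphicOrderAt_nonneg h
        (hf.1 z (hline z hre)).meromorphicOrderAt_nonneg hz
    · rw [← S.countP_rightOfStrip_eq hΛ h hf hr.1 hr.2, hp]

end LTISystem

end Strip

end

theorem theorem8 {n : ℕ} (S : LTISystem n) (p : ℕ) (lo hi : EReal) (hΛ : lo < hi) :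
    (∀ r : ℝ, S.gainAt p r = ⨅ (γ : ℝ≥0) (_ : S.LMISolvable p r γ), (γ : ℝ≥0∞)) ∧
    (S.gain p lo hi < ⊤ →
      MemHInf lo hi S.transfer ∧ S.gain p lo hi = hInfNorm lo hi S.transfer) ∧
    (HasPoleCount S.transfer Set.univ n →
      (S.gain p lo hi < ⊤ ↔ MemHInfP p lo hi S.transfer)) :=
  ⟨S.gainAt_eq_iInf_lmiSolvable p, S.memHInf_and_gain_eq p lo hi,
    S.gain_lt_top_iff_memHInfP p hΛ⟩
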